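/- Let $\Phi=\{\Phi(t)\}_{t\in\mathbb R}$ be a (jointly measurable) real-valued, mean-square continuous, stationary Gaussian process whose covariance function has a spectral density $p:\mathbb R\to(0,\infty)$, $p\in L^1(\mathbb R)$, i.e. $\operatorname{Cov}(\Phi(t),\Phi(0))=\int_{\mathbb R}e^{it\lambda}p(\lambda)\,d\lambda$ for all $t$. Assume that there are constants $\gamma\in(0,2)$ and $C_1>0$ with $p(\lambda)\le C_1|\lambda|^{-(1+\gamma)}$ for all $\lambda\ne0$, and that one of the following holds: (b1) $p(\lambda)=L(|\lambda|^{-1})|\lambda|^{H-1}$ for $\lambda\neq 0$, where $H\in(0,1)$ and $L:(0,\infty)\to(0,\infty)$ is locally bounded and slowly varying at infinity ($L(cr)/L(r)\to1$ as $r\to\infty$ for every $c>0$); (b2) $p$ is bounded and is continuous at the origin. Let $\psi\in L^1(\mathbb R)\cap L^2(\mathbb R)$ be complex-valued, let $\widehat\psi(\omega)=\int_{\mathbb R}e^{-it\omega}\psi(t)\,dt$, and assume that $\psi$ is analytic, i.e. $\widehat\psi(\omega)=0$ for $\omega\le0$, and that $\widehat\psi$ is Lipschitz continuous on $[0,\infty)$,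 with smallest Lipschitz constant $\|\widehat\psi\|_{\mathrm{Lip}}$. For $s>0$ put $$W_\Phi(0,s)=\int_{\mathbb R}\Phi(\tau)\,\frac1s\,\overline{\psi\!\left(\frac{\tau}{s}\right)}\,d\tau .$$ Fix $H^-\in(0,H)$ in case (b1), and $H^-\in(0,1]$ in case (b2). Then: 1. The process $(W_\Phi(0,s))_{s>0}$ has a version with almost surely continuous paths on $(0,\infty)$; suprema over $s>0$ are taken for such a version. 2. If $H^-<1$ (which is automatic in case (b1)), there is a threshold $T>0$ such that $$\mathbb E\big[|W_\Phi(0,s)|^2\big]\le s^{-H^-}\qquad\text{for all } s\ge T. \tag{$*$}$$ 3. For every $T>0$ satisfying $(*)$ and every version of $(W_\Phi(0,s))_{s>0}$ with almost surely continuous paths, $$\mathbb E\Big[\sup_{s>0}|W_\Phi(0,s)|\Big]\le 4\left[\sqrt{\ln\mathcal D}\,\frac{\mathcal D^3}{(\mathcal D-1)^2}\sqrt{\frac1\gamma+\frac1{H^-}}+\left(\sqrt{\frac1\gamma\ln C_2}+\sqrt{\ln (T\vee 1)}\right)\frac{\mathcal D^2}{\mathcal D-1}\right],$$ where $$\mathcal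 D=2\vee\Big\{\sup_{s>0}\mathbb E\big[|W_\Phi(0,s)|^2\big]\Big\}^{1/2},$$ $$C_2=1\vee\Big[C_1\Big(\frac1\gamma+\frac2{2-\gamma}\Big)(2\|\widehat\psi\|_\infty)^{2-\gamma}\|\widehat\psi\|_{\mathrm{Lip}}^{\gamma}+2\|\widehat\psi\|_\infty^2\operatorname{Var}(\Phi(0))\Big]^{1/2}.$$ -/

import Mathlib

open MeasureTheory ProbabilityTheory Filter Topology Set

noncomputable section

namespace AWT

/-! ### Analytic wavelet transform -/

/-- The Fourier transform `ψ̂(ω) = ∫ e^{-itω} ψ(t) dt`. -/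
def fourierHat (ψ : ℝ → ℂ) (ω : ℝ) : ℂ :=
  ∫ t : ℝ, Complex.exp (-(Complex.I * (t : ℂ) * (ω : ℂ))) * ψ t

/-- `ψ ∈ L¹ ∩ L²` and `ψ̂(ω) = 0` for all `ω ≤ 0`. -/
structure IsAnalyticWavelet (ψ : ℝ → ℂ) : Prop where
  integrable : Integrable ψ
  memLp_two : MemLp ψ 2
  fourierHat_eq_zero : ∀ ω : ℝ, ω ≤ 0 → fourierHat ψ ω = 0

/-- `W_f(t,s) = ∫ f(τ) s⁻¹ conj (ψ((τ - t)/s)) dτ`. -/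
def awt (ψ : ℝ → ℂ) (f : ℝ → ℂ) (t s : ℝ) : ℂ :=
  ∫ τ : ℝ, f τ * ((1 / s : ℝ) : ℂ) * (starRingEnd ℂ) (ψ ((τ - t) / s))

/-- The supremum norm `‖g‖_∞`. -/
def supNorm (g : ℝ → ℂ) : ℝ := ⨆ x : ℝ, ‖g x‖

/-- The (smallest) Lipschitz constant of `g` on `[0, ∞)`. -/
def lipConst (g : ℝ → ℂ) : ℝ :=
  ⨆ q : Ici (0 : ℝ) × Ici (0 : ℝ),
    ‖g (q.1 : ℝ) - g (q.2 : ℝ)‖ / |(q.1 : ℝ) - (q.2 : ℝ)|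

/-! ### The noise -/

/-- A strictly stationary process: finite dimensional laws are invariant under time shifts. -/
def IsStationary {Ω : Type*} [MeasurableSpace Ω] (P : Measure Ω) (Φ : ℝ → Ω → ℝ) : Prop :=
  ∀ (h : ℝ) (n : ℕ) (t : Fin n → ℝ),
    IdentDistrib (fun ω i => Φ (t i + h) ω) (fun ω i => Φ (t i) ω) P P

/-- A mean-square continuous stationary (real) Gaussian process whose covariance function has the
spectral density `p : ℝ → (0, ∞)`. -/
structure IsGaussianNoise {Ω : Type*} [MeasurableSpace Ω] (P : Measure Ω) (Φ : ℝ → Ω → ℝ)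
    (p : ℝ → ℝ) : Prop where
  gaussian : IsGaussianProcess Φ P
  stationary : IsStationary P Φ
  meanSquare_continuous :
    ∀ t : ℝ, Tendsto (fun u : ℝ => ∫ ω, (Φ u ω - Φ t ω) ^ 2 ∂P) (𝓝 t) (𝓝 0)
  density_pos : ∀ l : ℝ, 0 < p l
  density_integrable : Integrable p
  covariance_eq : ∀ t : ℝ, ((cov[Φ t, Φ 0; P] : ℝ) : ℂ) =
    ∫ l : ℝ, Complex.exp (Complex.I * (t : ℂ) * (l : ℂ)) * ((p l : ℝ) : ℂ)

/-- `p(λ) ≤ C₁ |λ|^{-(1+γ)}` for `λ ≠ 0`, with `γ ∈ (0,2)` and `C₁ > 0`. -/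
structure HighFrequencyDecay (p : ℝ → ℝ) (γ C₁ : ℝ) : Prop where
  gamma_pos : 0 < γ
  gamma_lt_two : γ < 2
  const_pos : 0 < C₁
  bound : ∀ l : ℝ, l ≠ 0 → p l ≤ C₁ * |l| ^ (-(1 + γ))

/-- `L : (0,∞) → (0,∞)` is locally bounded and slowly varying at infinity. -/
structure IsSlowlyVarying (L : ℝ → ℝ) : Prop where
  pos : ∀ r : ℝ, 0 < r → 0 < L r
  locally_bounded : ∀ a b : ℝ, 0 < a → ∃ M : ℝ, ∀ r ∈ Icc a b, L r ≤ M
  ratio_tendsto : ∀ c : ℝ, 0 < c → Tendsto (fun r : ℝ => L (c * r) / L r) atTop (𝓝 1)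

/-- Long-range dependence with long-memory parameter `H ∈ (0,1)`:
`p(λ) = L(|λ|⁻¹) |λ|^{H-1}` with `L` slowly varying. -/
def LongRangeDependent (p : ℝ → ℝ) (H : ℝ) : Prop :=
  0 < H ∧ H < 1 ∧ ∃ L : ℝ → ℝ, IsSlowlyVarying L ∧
    ∀ l : ℝ, l ≠ 0 → p l = L (|l|⁻¹) * |l| ^ (H - 1)

/-- Short-range dependence: `p` is bounded, and continuous at the origin. -/
def ShortRangeDependent (p : ℝ → ℝ) : Prop :=
  (∃ M : ℝ, ∀ l : ℝ, p l ≤ M) ∧ ContinuousAt p 0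

/-! ### The transform of the noise at time `0` -/

section Noise

variable {Ω : Type*} [MeasurableSpace Ω]

/-- The random variable `W_Φ(0,s)`. -/
def awtNoise (ψ : ℝ → ℂ) (Φ : ℝ → Ω → ℝ) (s : ℝ) (ω : Ω) : ℂ :=
  awt ψ (fun τ => ((Φ τ ω : ℝ) : ℂ)) 0 s

/-- `W` is a version of the process `(W_Φ(0,s))_{s > 0}` with almost surely continuous paths. -/
structure IsContinuousVersion (P : Measure Ω) (ψ : ℝ → ℂ) (Φ : ℝ → Ω → ℝ)
    (W : ℝ → Ω → ℂ) : Prop where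
  ae_eq : ∀ s : ℝ, 0 < s → W s =ᵐ[P] awtNoise ψ Φ s
  continuousOn : ∀ᵐ ω ∂P, ContinuousOn (fun s => W s ω) (Ioi 0)

/-- `E |W_Φ(0,s)|²`. -/
def secondMoment (P : Measure Ω) (ψ : ℝ → ℂ) (Φ : ℝ → Ω → ℝ) (s : ℝ) : ℝ :=
  ∫ ω, ‖awtNoise ψ Φ s ω‖ ^ 2 ∂P

/-- `T` is a threshold beyond which `E |W_Φ(0,s)|² ≤ s^{-h}`. -/
def IsDecayThreshold (P : Measure Ω) (ψ : ℝ → ℂ) (Φ : ℝ → Ω → ℝ) (h T : ℝ) : Prop :=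
  0 < T ∧ ∀ s : ℝ, T ≤ s → secondMoment P ψ Φ s ≤ s ^ (-h)

/-- `𝒟 = 2 ∨ (sup_{s > 0} E |W_Φ(0,s)|²)^{1/2}`. -/
def diamConst (P : Measure Ω) (ψ : ℝ → ℂ) (Φ : ℝ → Ω → ℝ) : ℝ :=
  max 2 (Real.sqrt (⨆ s : Ioi (0 : ℝ), secondMoment P ψ Φ (s : ℝ)))

/-- The Hölder constant `C₂`, computed from `C₁`, `γ`, `ψ̂` and `Var(Φ(0))`. -/
def holderConst (P : Measure Ω) (ψ : ℝ → ℂ) (Φ : ℝ → Ω → ℝ) (γ C₁ : ℝ) : ℝ :=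
  max 1 (Real.sqrt
    (C₁ * (1 / γ + 2 / (2 - γ)) * (2 * supNorm (fourierHat ψ)) ^ (2 - γ)
        * lipConst (fourierHat ψ) ^ γ
      + 2 * supNorm (fourierHat ψ) ^ 2 * Var[Φ 0; P]))

end Noise

/-- The upper bound, as a function of `𝒟`, `γ`, `H⁻`, `C₂` and `T`; for `T < 1` the term `√(ln T)`
is read as `0`. -/
def dudleyBound (D γ h C₂ T : ℝ) : ℝ :=
  4 * (Real.sqrt (Real.log D) * (D ^ 3 / (D - 1) ^ 2) * Real.sqrt (1 / γ + 1 / h)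
    + (Real.sqrt (1 / γ * Real.log C₂) + Real.sqrt (Real.log (max 1 T))) * (D ^ 2 / (D - 1)))

end AWT

end

/-! The argument is Dudley's chaining, carried out with explicit constants on the index set
$[0,\infty)$ rather than $(0,\infty)$. At $s=0$ the transform is $0$, which serves as the base
point.

Geometry. Since $\widehat\psi(0)=0$, the mean of $\Phi$ drops out, and the spectral isometry
(`IsGaussianNoise.integral_sq_weight`) gives $E|W(s)-W(t)|^2=\int
p(\lambda)|\widehat\psi(s\lambda)-\widehat\psi(t\lambda)|^2d\lambda$, written `distSq p ψ s t`. The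
decay of $p$ together with the Lipschitz bound makes this at most $C_2^2|s-t|^\gamma$
(`distSq_le_rpow`, `distSq_le_holderConst`). The behaviour of $p$ at low frequencies makes its value
at $(s,0)$ at most $s^{-h}$ for large $s$ (`exists_forall_distSq_le_rpow`), where $h=H^-$. Far
scales are therefore all close to $0$, so the half-line has finite nets (`exists_net`).

Probability. Increments lie in the closed complex span of the centred process, where
$E\exp(\tau|X|)\le 4\exp(\tau^2E|X|^2)$ (`lintegral_exp_norm_weight_le`). This yields a maximal
inequality for finite families (`lintegral_iSup_le_of_exp`).

Chaining along nets of mesh $\mathcal D,1,\mathcal D^{-1},\mathcal D^{-2},\dots$ bounds the supremum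
over finite sets by an arithmetic-geometric series, whose sum is exactly `dudleyBound`
(`hasSum_dudleyBound`). Dyadic approximation produces the continuous version, and for any such
version the full supremum is reached through the rationals. -/

set_option linter.unusedSectionVars false

namespace AWT

/-! ### Random integrals $\int g(\tau)F(\tau,\cdot)\,d\tau$ in $L^2$ -/

section WeightedIntegral

variable {Ω : Type*} [MeasurableSpace Ω] {P : Measure Ω} [IsProbabilityMeasure P]

/-- The product `g(τ) F(τ, ω) Y(ω)` is integrable if `g` is integrable, `F` has bounded second
moments and `Y` is square integrable. -/
theorem integrable_prod_weight {F : ℝ → Ω → ℂ}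
    (hF : Measurable (fun q : ℝ × Ω => F q.1 q.2)) {V : ℝ}
    (hF2 : ∀ t, MemLp (F t) 2 P) (hV : ∀ t, ∫ ω, ‖F t ω‖ ^ 2 ∂P ≤ V)
    {g : ℝ → ℂ} (hg : Integrable g) {Y : Ω → ℂ} (hY : MemLp Y 2 P) :
    Integrable (fun q : ℝ × Ω => g q.1 * F q.1 q.2 * Y q.2) (volume.prod P) := by
  have hYm := hY.aestronglyMeasurable
  have hmeas : AEStronglyMeasurable (fun q : ℝ × Ω => g q.1 * F q.1 q.2 * Y q.2)
      (volume.prod P) :=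
    (hg.aestronglyMeasurable.comp_fst.mul hF.aestronglyMeasurable).mul hYm.comp_snd
  have hFY : ∀ t, Integrable (fun ω => F t ω * Y ω) P := fun t => (hF2 t).integrable_mul hY
  refine (integrable_prod_iff hmeas).2 ⟨?_, ?_⟩
  · refine ae_of_all _ fun t => ?_
    simpa only [mul_assoc] using (hFY t).const_mul (g t)
  · have hYi := (memLp_two_iff_integrable_sq_norm hYm).1 hY
    refine (hg.norm.mul_const ((V + ∫ ω, ‖Y ω‖ ^ 2 ∂P) / 2)).mono'
      (hmeas.norm.integral_prod_right') (ae_of_all _ fun t => ?_)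
    rw [Real.norm_of_nonneg (integral_nonneg fun _ => norm_nonneg _)]
    have h1 : ∀ ω, ‖g t * F t ω * Y ω‖ = ‖g t‖ * ‖F t ω * Y ω‖ := fun ω => by
      simp only [norm_mul, mul_assoc]
    simp only [h1]
    rw [integral_const_mul]
    refine mul_le_mul_of_nonneg_left ?_ (norm_nonneg _)
    have hFi := (memLp_two_iff_integrable_sq_norm (hF2 t).aestronglyMeasurable).1 (hF2 t)
    calc ∫ ω, ‖F t ω * Y ω‖ ∂P ≤ ∫ ω, (‖F t ω‖ ^ 2 + ‖Y ω‖ ^ 2) / 2 ∂P := by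
          refine integral_mono (hFY t).norm ((hFi.add hYi).div_const 2) fun ω => ?_
          simp only [norm_mul]
          nlinarith [sq_nonneg (‖F t ω‖ - ‖Y ω‖)]
      _ = ((∫ ω, ‖F t ω‖ ^ 2 ∂P) + ∫ ω, ‖Y ω‖ ^ 2 ∂P) / 2 := by
          rw [integral_div, integral_add hFi hYi]
      _ ≤ _ := by linarith [hV t]

/-- Almost surely, `g F(·, ω)` is integrable. -/
theorem ae_integrable_weight {F : ℝ → Ω → ℂ}
    (hF : Measurable (fun q : ℝ × Ω => F q.1 q.2)) {V : ℝ}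
    (hF2 : ∀ t, MemLp (F t) 2 P) (hV : ∀ t, ∫ ω, ‖F t ω‖ ^ 2 ∂P ≤ V)
    {g : ℝ → ℂ} (hg : Integrable g) :
    ∀ᵐ ω ∂P, Integrable (fun t => g t * F t ω) := by
  have h := integrable_prod_weight hF hF2 hV hg (memLp_const (1 : ℂ))
  simpa using h.prod_left_ae

/-- `∫ g(τ) F(τ, ·) dτ` is square integrable. -/
theorem memLp_weight {F : ℝ → Ω → ℂ}
    (hF : Measurable (fun q : ℝ × Ω => F q.1 q.2)) {V : ℝ}
    (hF2 : ∀ t, MemLp (F t) 2 P) (hV : ∀ t, ∫ ω, ‖F t ω‖ ^ 2 ∂P ≤ V)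
    {g : ℝ → ℂ} (hg : Integrable g) :
    MemLp (fun ω => ∫ t, g t * F t ω) 2 P := by
  have hgm := hg.aestronglyMeasurable
  have hm2 : AEStronglyMeasurable (fun q : ℝ × Ω => ‖g q.1‖ * ‖F q.1 q.2‖ ^ 2)
      (volume.prod P) :=
    hgm.norm.comp_fst.mul (hF.norm.pow_const 2).aestronglyMeasurable
  have hsq : Integrable (fun q : ℝ × Ω => ‖g q.1‖ * ‖F q.1 q.2‖ ^ 2) (volume.prod P) := by
    refine (integrable_prod_iff hm2).2 ⟨ae_of_all _ fun t => ?_, ?_⟩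
    · exact ((memLp_two_iff_integrable_sq_norm (hF2 t).aestronglyMeasurable).1
        (hF2 t)).const_mul ‖g t‖
    · refine (hg.norm.mul_const V).mono' (hm2.norm.integral_prod_right')
        (ae_of_all _ fun t => ?_)
      rw [Real.norm_of_nonneg (integral_nonneg fun _ => norm_nonneg _)]
      simp only [norm_mul, norm_norm, norm_pow]
      rw [integral_const_mul]
      exact mul_le_mul_of_nonneg_left (hV t) (norm_nonneg _)
  have hm : AEStronglyMeasurable (fun q : ℝ × Ω => g q.1 * F q.1 q.2) (volume.prod P) :=
    hgm.comp_fst.mul hF.aestronglyMeasurable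
  have hXm : AEStronglyMeasurable (fun ω => ∫ t, g t * F t ω) P :=
    hm.prod_swap.integral_prod_right'
  refine (memLp_two_iff_integrable_sq_norm hXm).2 ?_
  set G := ∫ t, ‖g t‖ with hG
  refine (hsq.integral_prod_right.const_mul G).mono' (hXm.norm.pow 2) ?_
  filter_upwards [hsq.prod_left_ae, ae_integrable_weight hF hF2 hV hg] with ω h1 h2
  have hG0 : 0 ≤ G := integral_nonneg fun _ => norm_nonneg _
  set A := ∫ t, ‖g t‖ * ‖F t ω‖ with hA
  set B := ∫ t, ‖g t‖ * ‖F t ω‖ ^ 2 with hB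
  have hA0 : 0 ≤ A := integral_nonneg fun _ => by positivity
  have h3 : Integrable (fun t => ‖g t‖ * ‖F t ω‖) := by simpa only [norm_mul] using h2.norm
  have hle : ‖∫ t, g t * F t ω‖ ≤ A := by
    refine (norm_integral_le_integral_norm _).trans_eq ?_
    simp only [norm_mul, hA]
  -- `∫ ‖g‖ (G ‖F‖ - A)² ≥ 0`
  have hquad : 0 ≤ G ^ 2 * B - 2 * G * A * A + A ^ 2 * G := by
    have h4 : ∫ t, (‖g t‖ * (G * ‖F t ω‖ - A) ^ 2)
        = G ^ 2 * B - 2 * G * A * A + A ^ 2 * G := by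
      have : (fun t => ‖g t‖ * (G * ‖F t ω‖ - A) ^ 2) = fun t =>
          G ^ 2 * (‖g t‖ * ‖F t ω‖ ^ 2) - 2 * G * A * (‖g t‖ * ‖F t ω‖) + A ^ 2 * ‖g t‖ := by
        ext t; ring
      have h5 : Integrable fun t => G ^ 2 * (‖g t‖ * ‖F t ω‖ ^ 2)
          - 2 * G * A * (‖g t‖ * ‖F t ω‖) := (h1.const_mul _).sub (h3.const_mul _)
      rw [this, integral_add h5 (hg.norm.const_mul _),
        integral_sub (h1.const_mul _) (h3.const_mul _), integral_const_mul, integral_const_mul,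
        integral_const_mul]
    rw [← h4]
    exact integral_nonneg fun _ => by positivity
  rw [Real.norm_of_nonneg (by positivity)]
  -- What remains is Cauchy–Schwarz for the measure $|g|\,dt$, namely $A^2\le GB$. It follows from
  -- `hquad`, which equals $G(GB-A^2)$, after dividing by $G$; if $G=0$ then $A=0$ as well.
  refine (pow_le_pow_left₀ (norm_nonneg _) hle 2).trans ?_
  rcases hG0.eq_or_lt with h0 | h0
  · have hg0 : ∀ᵐ t, ‖g t‖ = 0 :=
      (integral_eq_zero_iff_of_nonneg (fun _ => norm_nonneg _) hg.norm).1 h0.symm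
    have : A = 0 := by
      rw [hA]
      exact integral_eq_zero_of_ae (hg0.mono fun t ht => by simp [ht])
    simp [this, ← h0]
  · have : 0 ≤ G * (G * B - A ^ 2) := by nlinarith
    have := nonneg_of_mul_nonneg_right this h0
    change A ^ 2 ≤ G * B
    linarith

/-- Fubini for `E[conj Y ∫ g(τ) F(τ, ·) dτ]`. -/
theorem integral_mul_weight {F : ℝ → Ω → ℂ}
    (hF : Measurable (fun q : ℝ × Ω => F q.1 q.2)) {V : ℝ}
    (hF2 : ∀ t, MemLp (F t) 2 P) (hV : ∀ t, ∫ ω, ‖F t ω‖ ^ 2 ∂P ≤ V)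
    {g : ℝ → ℂ} (hg : Integrable g) {Y : Ω → ℂ} (hY : MemLp Y 2 P) :
    ∫ ω, (∫ t, g t * F t ω) * Y ω ∂P = ∫ t, g t * ∫ ω, F t ω * Y ω ∂P := by
  have h := integrable_prod_weight hF hF2 hV hg hY
  calc ∫ ω, (∫ t, g t * F t ω) * Y ω ∂P = ∫ ω, (∫ t, g t * F t ω * Y ω) ∂P := by
        simp only [integral_mul_const]
    _ = ∫ t, ∫ ω, g t * F t ω * Y ω ∂P := (integral_integral_swap h).symm
    _ = _ := by simp only [mul_assoc, integral_const_mul]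

end WeightedIntegral

/-! ### Exponential moments on the closed linear span of a Gaussian process -/

section SubGaussian

variable {Ω : Type*} [MeasurableSpace Ω] {P : Measure Ω}

/-- The real part of `X ∈ L²` has the exponential moments of a centred Gaussian variable with
variance `‖X‖²`, at most. -/
def IsExpBounded (X : Lp ℂ 2 P) : Prop :=
  ∀ τ : ℝ, ∫⁻ ω, ENNReal.ofReal (Real.exp (τ * (X ω).re)) ∂P ≤
    ENNReal.ofReal (Real.exp (τ ^ 2 * ‖X‖ ^ 2 / 2))

theorem measurable_ofReal_exp_re (τ : ℝ) :
    Measurable fun z : ℂ => ENNReal.ofReal (Real.exp (τ * z.re)) := by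
  fun_prop

/-- An $L^2$-convergent sequence has an almost surely convergent subsequence. Fatou handles the left
side and continuity of the norm the right side. This extends the bound from the span to its closure.
-/
theorem isClosed_isExpBounded : IsClosed {X : Lp ℂ 2 P | IsExpBounded X} := by
  refine IsSeqClosed.isClosed fun u X hu hX τ => ?_
  obtain ⟨ns, hns, hae⟩ := (tendstoInMeasure_of_tendsto_Lp hX).exists_seq_tendsto_ae
  have hcont : Continuous fun z : ℂ => ENNReal.ofReal (Real.exp (τ * z.re)) :=
    ENNReal.continuous_ofReal.comp (by fun_prop)
  have h1 : ∫⁻ ω, ENNReal.ofReal (Real.exp (τ * (X ω).re)) ∂P =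
      ∫⁻ ω, liminf (fun i => ENNReal.ofReal (Real.exp (τ * (u (ns i) ω).re))) atTop ∂P := by
    refine lintegral_congr_ae ?_
    filter_upwards [hae] with ω hω
    exact ((hcont.tendsto _).comp hω).liminf_eq.symm
  have h2 : Tendsto (fun i => ENNReal.ofReal (Real.exp (τ ^ 2 * ‖u (ns i)‖ ^ 2 / 2))) atTop
      (𝓝 (ENNReal.ofReal (Real.exp (τ ^ 2 * ‖X‖ ^ 2 / 2)))) := by
    have hc : Continuous fun Y : Lp ℂ 2 P =>
        ENNReal.ofReal (Real.exp (τ ^ 2 * ‖Y‖ ^ 2 / 2)) :=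
      ENNReal.continuous_ofReal.comp (by fun_prop)
    exact (hc.tendsto X).comp (hX.comp hns.tendsto_atTop)
  rw [h1]
  refine (lintegral_liminf_le' fun i => ?_).trans ?_
  · exact (measurable_ofReal_exp_re τ).comp_aemeasurable
      (Lp.aestronglyMeasurable _).aemeasurable
  · rw [← h2.liminf_eq]
    exact liminf_le_liminf (Eventually.of_forall fun i => hu (ns i) τ)

theorem sq_norm_toLp {f : Ω → ℂ} (hf : MemLp f 2 P) :
    ‖hf.toLp f‖ ^ 2 = ∫ ω, ‖f ω‖ ^ 2 ∂P := by
  have h := L2.inner_def (𝕜 := ℂ) (hf.toLp f) (hf.toLp f)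
  rw [inner_self_eq_norm_sq_to_K] at h
  have h2 : ∫ ω, inner ℂ (hf.toLp f ω) (hf.toLp f ω) ∂P = ((∫ ω, ‖f ω‖ ^ 2 ∂P : ℝ) : ℂ) := by
    rw [← integral_complex_ofReal]
    refine integral_congr_ae ?_
    filter_upwards [hf.coeFn_toLp] with ω hω
    rw [hω, inner_self_eq_norm_sq_to_K]
    simp
  rw [h2] at h
  exact Complex.ofReal_injective (by simpa using h)

theorem lintegral_exp_centred_gaussian [IsProbabilityMeasure P] {Z : Ω → ℝ}
    (hZ : HasGaussianLaw Z P) (τ : ℝ) :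
    ∫⁻ ω, ENNReal.ofReal (Real.exp (τ * (Z ω - ∫ x, Z x ∂P))) ∂P =
      ENNReal.ofReal (Real.exp (τ ^ 2 * Var[Z; P] / 2)) := by
  have hlaw := hZ.map_eq_gaussianReal
  have hint : Integrable (fun ω => Real.exp (τ * Z ω)) P := by
    have := integrable_exp_mul_gaussianReal (μ := ∫ x, Z x ∂P) (v := Var[Z; P].toNNReal) τ
    rw [← hlaw] at this
    exact this.comp_aemeasurable hZ.aemeasurable
  have hmgf := mgf_gaussianReal hlaw τ
  rw [Real.coe_toNNReal _ (variance_nonneg _ _)] at hmgf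
  have hsplit : (fun ω => Real.exp (τ * (Z ω - ∫ x, Z x ∂P))) =
      fun ω => Real.exp (-(τ * ∫ x, Z x ∂P)) * Real.exp (τ * Z ω) := by
    ext ω; rw [← Real.exp_add]; congr 1; ring
  rw [← ofReal_integral_eq_lintegral_ofReal _ (ae_of_all _ fun _ => (Real.exp_pos _).le)]
  · congr 1
    rw [hsplit, integral_const_mul]
    change _ * mgf Z P τ = _
    rw [hmgf, ← Real.exp_add]
    congr 1; ring
  · rw [hsplit]; exact hint.const_mul _

/-- Elements of the linear span of a centred Gaussian process are exponentially bounded. -/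
theorem isExpBounded_of_mem_span [IsProbabilityMeasure P] {Φ : ℝ → Ω → ℝ}
    (hΦ : IsGaussianProcess Φ P) {F : ℝ → Ω → ℂ} (hF : ∀ t, MemLp (F t) 2 P)
    (hFΦ : ∀ t ω, F t ω = ((Φ t ω - ∫ x, Φ t x ∂P : ℝ) : ℂ)) {X : Lp ℂ 2 P}
    (hX : X ∈ Submodule.span ℂ (range fun t => (hF t).toLp (F t))) : IsExpBounded X := by
  obtain ⟨c, rfl⟩ := Finsupp.mem_span_range_iff_exists_finsupp.1 hX
  set X : Lp ℂ 2 P := c.sum fun i a => a • (hF i).toLp (F i) with hXdef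
  have hXae : X =ᵐ[P] fun ω => ∑ i ∈ c.support, c i * F i ω := by
    have h1 : X =ᵐ[P] fun ω => ∑ i ∈ c.support, (c i • (hF i).toLp (F i) : Lp ℂ 2 P) ω :=
      Lp.coeFn_fun_finsetSum _ _
    have h2 : ∀ᵐ ω ∂P, ∀ i ∈ c.support,
        (c i • (hF i).toLp (F i) : Lp ℂ 2 P) ω = c i * F i ω := by
      refine (ae_ball_iff c.support.countable_toSet).2 fun i _ => ?_
      filter_upwards [Lp.coeFn_smul (c i) ((hF i).toLp (F i)), (hF i).coeFn_toLp] with ω h3 h4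
      rw [h3, Pi.smul_apply, h4, smul_eq_mul]
    filter_upwards [h1, h2] with ω h3 h4
    rw [h3]
    exact Finset.sum_congr rfl h4
  -- The `F i` are real, so the real part of the combination only sees the real parts of the
  -- coefficients: it is a centred real Gaussian, with variance at most $\|X\|^2$.
  set Z : Ω → ℝ := fun ω => ∑ i ∈ c.support, (c i).re • Φ i ω with hZdef
  have hZ : HasGaussianLaw Z P := (hΦ.smul fun i => (c i).re).hasGaussianLaw_fun_sum
  have hEZ : ∫ x, Z x ∂P = ∑ i ∈ c.support, (c i).re * ∫ x, Φ i x ∂P := by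
    rw [hZdef, integral_finsetSum]
    · simp only [smul_eq_mul, integral_const_mul]
    · exact fun i _ => (hΦ.hasGaussianLaw_eval i).integrable.const_mul _
  have hre : ∀ᵐ ω ∂P, (X ω).re = Z ω - ∫ x, Z x ∂P := by
    filter_upwards [hXae] with ω hω
    rw [hω, Complex.re_sum, hEZ, hZdef, ← Finset.sum_sub_distrib]
    refine Finset.sum_congr rfl fun i _ => ?_
    rw [hFΦ, Complex.re_mul_ofReal, smul_eq_mul]; ring
  have hvar : Var[Z; P] ≤ ‖X‖ ^ 2 := by
    have h1 : ‖X‖ ^ 2 = ∫ ω, ‖X ω‖ ^ 2 ∂P := by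
      have := sq_norm_toLp (Lp.memLp X)
      rwa [Lp.toLp_coeFn] at this
    rw [variance_eq_integral hZ.aemeasurable, h1]
    refine integral_mono_of_nonneg (ae_of_all _ fun _ => sq_nonneg _)
      ((memLp_two_iff_integrable_sq_norm (Lp.aestronglyMeasurable X)).1 (Lp.memLp X)) ?_
    filter_upwards [hre] with ω hω
    rw [← hω, ← sq_abs]
    exact pow_le_pow_left₀ (abs_nonneg _) (Complex.abs_re_le_norm _) 2
  intro τ
  calc ∫⁻ ω, ENNReal.ofReal (Real.exp (τ * (X ω).re)) ∂P
      = ∫⁻ ω, ENNReal.ofReal (Real.exp (τ * (Z ω - ∫ x, Z x ∂P))) ∂P :=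
        lintegral_congr_ae (hre.mono fun ω hω => by simp only [hω])
    _ = ENNReal.ofReal (Real.exp (τ ^ 2 * Var[Z; P] / 2)) := lintegral_exp_centred_gaussian hZ τ
    _ ≤ _ := by gcongr

/-- A complex subspace contains $iX$ along with $X$, so bounds on real parts also control imaginary
parts, with no joint law needed. From $|z|\le\sqrt2\max(|\mathrm{Re}\,z|,|\mathrm{Im}\,z|)$, the
exponential of $\tau|z|$ is at most a sum of four exponentials with parameter $\pm\sqrt2\,\tau$.
This is the source of the factor $4$ and of the missing $1/2$ in the exponent. -/
theorem lintegral_exp_norm_le {K : Submodule ℂ (Lp ℂ 2 P)} (hK : ∀ X ∈ K, IsExpBounded X)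
    {X : Lp ℂ 2 P} (hX : X ∈ K) (τ : ℝ) (hτ : 0 ≤ τ) :
    ∫⁻ ω, ENNReal.ofReal (Real.exp (τ * ‖X ω‖)) ∂P ≤
      ENNReal.ofReal (4 * Real.exp (τ ^ 2 * ‖X‖ ^ 2)) := by
  set σ := τ * √2 with hσ
  have hσ2 : σ ^ 2 = 2 * τ ^ 2 := by
    rw [hσ, mul_pow, Real.sq_sqrt (by norm_num)]; ring
  have hσ0 : 0 ≤ σ := by positivity
  set e : ℝ → ENNReal := fun x => ENNReal.ofReal (Real.exp x) with he
  have hpt : ∀ z : ℂ, e (τ * ‖z‖) ≤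
      (e (σ * z.re) + e (-σ * z.re)) + (e (σ * (Complex.I * z).re) + e (-σ * (Complex.I * z).re)) := by
    intro z
    have hmono : ∀ x y, x ≤ y → e x ≤ e y := fun x y h =>
      ENNReal.ofReal_le_ofReal (Real.exp_le_exp.2 h)
    have habs : ‖z‖ ≤ √2 * max |z.re| |z.im| := Complex.norm_le_sqrt_two_mul_max z
    have h1 : τ * ‖z‖ ≤ σ * max |z.re| |z.im| := by
      rw [hσ, mul_assoc]; exact mul_le_mul_of_nonneg_left habs hτ
    have hI : (Complex.I * z).re = -z.im := by simp
    rw [hI]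
    rcases le_total |z.re| |z.im| with h | h
    · rw [max_eq_right h] at h1
      refine le_add_left ?_
      rcases abs_cases z.im with ⟨h2, _⟩ | ⟨h2, _⟩ <;> rw [h2] at h1
      · exact le_add_left (hmono _ _ (by linarith))
      · exact le_add_right (hmono _ _ (by linarith))
    · rw [max_eq_left h] at h1
      refine le_add_right ?_
      rcases abs_cases z.re with ⟨h2, _⟩ | ⟨h2, _⟩ <;> rw [h2] at h1
      · exact le_add_right (hmono _ _ (by linarith))
      · exact le_add_left (hmono _ _ (by linarith))
  have hXm : AEMeasurable X P := (Lp.aestronglyMeasurable X).aemeasurable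
  have hm : ∀ r : ℝ, AEMeasurable (fun ω => e (r * (X ω).re)) P := fun r =>
    (measurable_ofReal_exp_re r).comp_aemeasurable hXm
  have hmI : ∀ r : ℝ, AEMeasurable (fun ω => e (r * (Complex.I * X ω).re)) P := fun r =>
    (measurable_ofReal_exp_re r).comp_aemeasurable (hXm.const_mul _)
  have hb : ∀ r : ℝ, r ^ 2 = 2 * τ ^ 2 →
      ∫⁻ ω, e (r * (X ω).re) ∂P ≤ e (τ ^ 2 * ‖X‖ ^ 2) := fun r hr => by
    have := hK X hX r
    rwa [hr, show 2 * τ ^ 2 * ‖X‖ ^ 2 / 2 = τ ^ 2 * ‖X‖ ^ 2 by ring] at this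
  have hbI : ∀ r : ℝ, r ^ 2 = 2 * τ ^ 2 →
      ∫⁻ ω, e (r * (Complex.I * X ω).re) ∂P ≤ e (τ ^ 2 * ‖X‖ ^ 2) := fun r hr => by
    have := hK (Complex.I • X) (K.smul_mem _ hX) r
    rw [norm_smul, Complex.norm_I, one_mul, hr,
      show 2 * τ ^ 2 * ‖X‖ ^ 2 / 2 = τ ^ 2 * ‖X‖ ^ 2 by ring] at this
    refine (lintegral_congr_ae ?_).trans_le this
    filter_upwards [Lp.coeFn_smul Complex.I X] with ω hω
    rw [hω, Pi.smul_apply, smul_eq_mul]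
  calc ∫⁻ ω, e (τ * ‖X ω‖) ∂P
      ≤ ∫⁻ ω, ((e (σ * (X ω).re) + e (-σ * (X ω).re))
        + (e (σ * (Complex.I * X ω).re) + e (-σ * (Complex.I * X ω).re))) ∂P :=
        lintegral_mono fun ω => hpt _
    _ = (∫⁻ ω, e (σ * (X ω).re) ∂P + ∫⁻ ω, e (-σ * (X ω).re) ∂P)
        + (∫⁻ ω, e (σ * (Complex.I * X ω).re) ∂P + ∫⁻ ω, e (-σ * (Complex.I * X ω).re) ∂P) := by
        have h2 : AEMeasurable (fun ω => e (σ * (X ω).re) + e (-σ * (X ω).re)) P :=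
          (hm _).add (hm _)
        rw [lintegral_add_left' h2, lintegral_add_left' (hm _), lintegral_add_left' (hmI _)]
    _ ≤ (e (τ ^ 2 * ‖X‖ ^ 2) + e (τ ^ 2 * ‖X‖ ^ 2))
        + (e (τ ^ 2 * ‖X‖ ^ 2) + e (τ ^ 2 * ‖X‖ ^ 2)) :=
        add_le_add (add_le_add (hb _ hσ2) (hb _ (by rw [neg_sq, hσ2])))
          (add_le_add (hbI _ hσ2) (hbI _ (by rw [neg_sq, hσ2])))
    _ = _ := by
        simp only [he]
        rw [← ENNReal.ofReal_add (by positivity) (by positivity),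
          ← ENNReal.ofReal_add (by positivity) (by positivity)]
        congr 1; ring

/-- Exponential moments of `∫ g(τ) F(τ, ·) dτ` for a centred Gaussian process `F`. -/
theorem lintegral_exp_norm_weight_le [IsProbabilityMeasure P] {Φ : ℝ → Ω → ℝ}
    (hΦ : IsGaussianProcess Φ P) {F : ℝ → Ω → ℂ}
    (hFΦ : ∀ t ω, F t ω = ((Φ t ω - ∫ x, Φ t x ∂P : ℝ) : ℂ))
    (hFm : Measurable (fun q : ℝ × Ω => F q.1 q.2)) {V : ℝ}
    (hF : ∀ t, MemLp (F t) 2 P) (hV : ∀ t, ∫ ω, ‖F t ω‖ ^ 2 ∂P ≤ V)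
    {g : ℝ → ℂ} (hg : Integrable g) (τ : ℝ) (hτ : 0 ≤ τ) :
    ∫⁻ ω, ENNReal.ofReal (Real.exp (τ * ‖∫ t, g t * F t ω‖)) ∂P ≤
      ENNReal.ofReal (4 * Real.exp (τ ^ 2 * ∫ ω, ‖∫ t, g t * F t ω‖ ^ 2 ∂P)) := by
  set K := Submodule.span ℂ (range fun t => (hF t).toLp (F t)) with hKdef
  have hX := memLp_weight hFm hF hV hg
  -- The closure is the double orthogonal complement: by Fubini, any $Y$ orthogonal to every $F_t$
  -- is orthogonal to $\int gF$. This avoids Riemann sums.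
  have hmem : hX.toLp _ ∈ K.topologicalClosure := by
    rw [← Submodule.orthogonal_orthogonal_eq_closure, Submodule.mem_orthogonal]
    intro Y hY
    have hYF : ∀ t, ∫ ω, F t ω * (starRingEnd ℂ) (Y ω) ∂P = 0 := fun t => by
      have h := (Submodule.mem_orthogonal' K Y).1 hY _ (Submodule.subset_span ⟨t, rfl⟩)
      rw [L2.inner_def] at h
      rw [← h]
      refine integral_congr_ae ?_
      filter_upwards [(hF t).coeFn_toLp] with ω hω
      rw [hω, RCLike.inner_apply]
    have hYm : MemLp (fun ω => (starRingEnd ℂ) (Y ω)) 2 P := (Lp.memLp Y).star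
    have h := integral_mul_weight hFm hF hV hg hYm
    simp only [hYF, mul_zero, integral_zero] at h
    rw [L2.inner_def, ← h]
    refine integral_congr_ae ?_
    filter_upwards [hX.coeFn_toLp] with ω hω
    rw [hω, RCLike.inner_apply]
  have hK : ∀ X ∈ K.topologicalClosure, IsExpBounded X := fun X hX =>
    closure_minimal (fun Y hY => isExpBounded_of_mem_span hΦ hF hFΦ hY)
      isClosed_isExpBounded hX
  have h := lintegral_exp_norm_le hK hmem τ hτ
  rw [sq_norm_toLp] at h
  refine (lintegral_congr_ae ?_).trans_le h
  filter_upwards [hX.coeFn_toLp] with ω hω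
  rw [hω]

end SubGaussian

/-! ### Elementary Fourier identities -/

theorem norm_exp_mul_eq_one {c : ℂ} (hc : c.re = 0) (t l : ℝ) :
    ‖Complex.exp (c * (t : ℂ) * (l : ℂ))‖ = 1 := by
  rw [Complex.norm_exp]; simp [hc]

/-- Fubini for a unimodular kernel. It is used with $c=\pm i$, to move a Fourier transform from the
spectral density to the weight. -/
theorem integral_exp_swap {c : ℂ} (hc : c.re = 0) {a b : ℝ → ℂ} (ha : Integrable a)
    (hb : Integrable b) :
    ∫ t : ℝ, a t * ∫ l : ℝ, Complex.exp (c * (t : ℂ) * (l : ℂ)) * b l =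
      ∫ l : ℝ, b l * ∫ t : ℝ, Complex.exp (c * (t : ℂ) * (l : ℂ)) * a t := by
  have hint : Integrable (Function.uncurry fun t l : ℝ =>
      Complex.exp (c * (t : ℂ) * (l : ℂ)) * (a t * b l)) (volume.prod volume) := by
    refine (ha.mul_prod hb).bdd_mul (c := 1) ?_ (ae_of_all _ fun q => ?_)
    · exact Continuous.aestronglyMeasurable (by fun_prop)
    · exact (norm_exp_mul_eq_one hc q.1 q.2).le
  have h := integral_integral_swap hint
  simp only [← integral_const_mul]
  refine Eq.trans ?_ (h.trans ?_)
  · congr 1; ext t; congr 1; ext l; ring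
  · congr 1; ext l; congr 1; ext t; ring

theorem fourierHat_eq (g : ℝ → ℂ) (w : ℝ) :
    fourierHat g w = ∫ t : ℝ, Complex.exp (-Complex.I * (t : ℂ) * (w : ℂ)) * g t := by
  simp only [fourierHat, neg_mul]

theorem conj_fourierHat_conj (g : ℝ → ℂ) (l : ℝ) :
    (starRingEnd ℂ) (fourierHat (fun t => (starRingEnd ℂ) (g t)) l) =
      ∫ t : ℝ, Complex.exp (Complex.I * (t : ℂ) * (l : ℂ)) * g t := by
  rw [fourierHat_eq, ← integral_conj]
  congr 1; ext t
  rw [map_mul, ← Complex.exp_conj]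
  simp

theorem norm_fourierHat_le (g : ℝ → ℂ) (w : ℝ) : ‖fourierHat g w‖ ≤ ∫ t, ‖g t‖ := by
  rw [fourierHat_eq]
  refine (norm_integral_le_integral_norm _).trans_eq ?_
  simp only [norm_mul, norm_exp_mul_eq_one (c := -Complex.I) (by simp), one_mul]

theorem continuous_fourierHat {g : ℝ → ℂ} (hg : Integrable g) : Continuous (fourierHat g) := by
  refine continuous_of_dominated (bound := fun t => ‖g t‖) (fun w => ?_) (fun w => ?_) hg.norm ?_
  · exact (Continuous.aestronglyMeasurable (by fun_prop)).mul hg.aestronglyMeasurable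
  · refine ae_of_all _ fun t => ?_
    rw [norm_mul, ← neg_mul, ← neg_mul, norm_exp_mul_eq_one (by simp), one_mul]
  · exact ae_of_all _ fun t => by fun_prop

/-! ### Stationarity, spectral isometry and the canonical distance -/

section Noise

variable {Ω : Type*} [MeasurableSpace Ω] {P : Measure Ω} [IsProbabilityMeasure P]
  {Φ : ℝ → Ω → ℝ} {p : ℝ → ℝ}

/-- The centred process, as a complex process. -/
noncomputable def centred (P : Measure Ω) (Φ : ℝ → Ω → ℝ) (t : ℝ) (ω : Ω) : ℂ :=
  ((Φ t ω - ∫ x, Φ t x ∂P : ℝ) : ℂ)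

namespace IsGaussianNoise

theorem memLp_two (hΦ : IsGaussianNoise P Φ p) (t : ℝ) : MemLp (Φ t) 2 P :=
  (hΦ.gaussian.hasGaussianLaw_eval t).memLp_two

theorem mean_eq (hΦ : IsGaussianNoise P Φ p) (t : ℝ) : ∫ x, Φ t x ∂P = ∫ x, Φ 0 x ∂P := by
  have h := hΦ.stationary t 1 fun _ => 0
  have h2 := (h.comp (measurable_pi_apply 0)).integral_eq
  simpa [Function.comp_def] using h2

theorem covariance_sub (hΦ : IsGaussianNoise P Φ p) (s t : ℝ) :
    cov[Φ s, Φ t; P] = cov[Φ (s - t), Φ 0; P] := by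
  have h := hΦ.stationary t 2 ![s - t, 0]
  set m := ∫ x, Φ 0 x ∂P with hm
  have hu : Measurable fun x : Fin 2 → ℝ => (x 0 - m) * (x 1 - m) := by fun_prop
  have h2 := (h.comp hu).integral_eq
  simp only [Function.comp_def, Matrix.cons_val_zero, Matrix.cons_val_one, sub_add_cancel,
    zero_add] at h2
  simp only [covariance, hΦ.mean_eq s, hΦ.mean_eq t, hΦ.mean_eq (s - t), ← hm]
  exact h2

theorem variance_eq (hΦ : IsGaussianNoise P Φ p) (t : ℝ) : Var[Φ t; P] = Var[Φ 0; P] := by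
  rw [← covariance_self (hΦ.memLp_two t).aestronglyMeasurable.aemeasurable,
    ← covariance_self (hΦ.memLp_two 0).aestronglyMeasurable.aemeasurable, hΦ.covariance_sub t t,
    sub_self]

theorem memLp_centred (hΦ : IsGaussianNoise P Φ p) (t : ℝ) : MemLp (centred P Φ t) 2 P :=
  ((hΦ.memLp_two t).sub (memLp_const _)).ofReal

theorem measurable_centred (hΦ : IsGaussianNoise P Φ p)
    (hm : Measurable (fun q : ℝ × Ω => Φ q.1 q.2)) :
    Measurable (fun q : ℝ × Ω => centred P Φ q.1 q.2) := by
  simp only [centred, hΦ.mean_eq]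
  exact Complex.measurable_ofReal.comp (hm.sub_const _)

theorem integral_sq_centred (hΦ : IsGaussianNoise P Φ p) (t : ℝ) :
    ∫ ω, ‖centred P Φ t ω‖ ^ 2 ∂P = Var[Φ 0; P] := by
  rw [← hΦ.variance_eq t,
    variance_eq_integral (hΦ.memLp_two t).aestronglyMeasurable.aemeasurable]
  simp only [centred, Complex.norm_real, Real.norm_eq_abs, sq_abs]

theorem integral_centred_mul (hΦ : IsGaussianNoise P Φ p) (s t : ℝ) :
    ∫ ω, centred P Φ s ω * (starRingEnd ℂ) (centred P Φ t ω) ∂P =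
      ∫ l : ℝ, Complex.exp (-Complex.I * (s : ℂ) * (l : ℂ)) *
        (Complex.exp (Complex.I * (t : ℂ) * (l : ℂ)) * ((p l : ℝ) : ℂ)) := by
  have h1 : ∫ ω, centred P Φ s ω * (starRingEnd ℂ) (centred P Φ t ω) ∂P =
      ((cov[Φ t, Φ s; P] : ℝ) : ℂ) := by
    rw [covariance, ← integral_complex_ofReal]
    congr 1; ext ω
    simp only [centred, Complex.conj_ofReal]
    push_cast; ring
  rw [h1, hΦ.covariance_sub, hΦ.covariance_eq]
  congr 1; ext l
  rw [← mul_assoc, ← Complex.exp_add]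
  congr 2
  push_cast; ring

/-- The spectral isometry. -/
theorem integral_sq_weight (hΦ : IsGaussianNoise P Φ p)
    (hm : Measurable (fun q : ℝ × Ω => Φ q.1 q.2)) {g : ℝ → ℂ} (hg : Integrable g) :
    ∫ ω, ‖∫ t, g t * centred P Φ t ω‖ ^ 2 ∂P =
      ∫ l, p l * ‖fourierHat (fun t => (starRingEnd ℂ) (g t)) l‖ ^ 2 := by
  have hFm := hΦ.measurable_centred hm
  have hF := hΦ.memLp_centred
  have hV := fun t => (hΦ.integral_sq_centred t).le
  set X : Ω → ℂ := fun ω => ∫ t, g t * centred P Φ t ω with hX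
  have hX2 : MemLp X 2 P := memLp_weight hFm hF hV hg
  have hgc : Integrable fun t => (starRingEnd ℂ) (g t) :=
    (LinearIsometryEquiv.integrable_comp_iff Complex.conjLIE).2 hg
  set G := fourierHat fun t => (starRingEnd ℂ) (g t) with hG
  have hpc : Integrable fun l => ((p l : ℝ) : ℂ) := hΦ.density_integrable.ofReal
  have hpG : Integrable fun l => ((p l : ℝ) : ℂ) * G l :=
    hpc.mul_bdd (c := ∫ t, ‖(starRingEnd ℂ) (g t)‖)
      (continuous_fourierHat hgc).aestronglyMeasurable (ae_of_all _ (norm_fourierHat_le _))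
  -- The double time integral of the covariance is unfolded one variable at a time. Pairing $X$ with
  -- a single $F_t$ produces one factor $G$; integrating against $g$ afterwards produces its
  -- conjugate.
  have hinner : ∀ t, ∫ ω, centred P Φ t ω * (starRingEnd ℂ) (X ω) ∂P =
      ∫ l : ℝ, Complex.exp (Complex.I * (t : ℂ) * (l : ℂ)) * (((p l : ℝ) : ℂ) * G l) := by
    intro t
    have hq : Integrable fun l : ℝ =>
        Complex.exp (Complex.I * (t : ℂ) * (l : ℂ)) * ((p l : ℝ) : ℂ) :=
      hpc.bdd_mul (c := 1) (Continuous.aestronglyMeasurable (by fun_prop))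
        (ae_of_all _ fun l => (norm_exp_mul_eq_one (by simp) t l).le)
    have h1 := integral_mul_weight hFm hF hV hg (Y := fun ω => (starRingEnd ℂ) (centred P Φ t ω))
      (hF t).star
    have h2 : ∫ ω, centred P Φ t ω * (starRingEnd ℂ) (X ω) ∂P =
        (starRingEnd ℂ) (∫ ω, X ω * (starRingEnd ℂ) (centred P Φ t ω) ∂P) := by
      rw [← integral_conj]
      simp only [map_mul, Complex.conj_conj, mul_comm]
    rw [h2, h1, ← integral_conj]
    have h3 : ∀ u, (starRingEnd ℂ)
        (g u * ∫ ω, centred P Φ u ω * (starRingEnd ℂ) (centred P Φ t ω) ∂P) =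
        (starRingEnd ℂ) (g u) * ∫ l : ℝ, Complex.exp (-Complex.I * (u : ℂ) * (l : ℂ)) *
          (Complex.exp (Complex.I * (t : ℂ) * (l : ℂ)) * ((p l : ℝ) : ℂ)) := by
      intro u
      rw [map_mul, ← hΦ.integral_centred_mul u t, ← integral_conj]
      simp only [centred, map_mul, Complex.conj_ofReal]
    simp only [h3]
    rw [integral_exp_swap (by simp) hgc hq]
    congr 1; ext l
    rw [← fourierHat_eq, mul_assoc]
  have hXY := integral_mul_weight hFm hF hV hg (Y := fun ω => (starRingEnd ℂ) (X ω)) hX2.star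
  simp only [hinner] at hXY
  rw [integral_exp_swap (by simp) hg hpG] at hXY
  have h4 : ∀ l : ℝ, ((p l : ℝ) : ℂ) * G l *
      ∫ t : ℝ, Complex.exp (Complex.I * (t : ℂ) * (l : ℂ)) * g t =
        ((p l : ℝ) : ℂ) * ((‖G l‖ ^ 2 : ℝ) : ℂ) := by
    intro l
    rw [← conj_fourierHat_conj, mul_assoc, Complex.mul_conj, Complex.normSq_eq_norm_sq]
  simp only [h4] at hXY
  rw [← Complex.ofReal_inj, ← integral_complex_ofReal, ← integral_complex_ofReal]
  simp only [Complex.ofReal_mul]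
  rw [← hXY]
  congr 1; ext ω
  change _ = X ω * (starRingEnd ℂ) (X ω)
  rw [Complex.mul_conj, Complex.normSq_eq_norm_sq]

end IsGaussianNoise

/-! ### The transform as a weighted integral -/

/-- The kernel `τ ↦ s⁻¹ conj (ψ(τ/s))`. -/
noncomputable def kernel (ψ : ℝ → ℂ) (s τ : ℝ) : ℂ := ((1 / s : ℝ) : ℂ) * (starRingEnd ℂ) (ψ (τ / s))

theorem integrable_kernel {ψ : ℝ → ℂ} (hψ : Integrable ψ) {s : ℝ} (hs : 0 ≤ s) :
    Integrable (kernel ψ s) := by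
  rcases hs.eq_or_lt with rfl | hs
  · have h : kernel ψ 0 = fun _ => 0 := by ext; simp [kernel]
    rw [h]
    exact integrable_zero _ _ _
  · have h := (LinearIsometryEquiv.integrable_comp_iff Complex.conjLIE).2
      (hψ.comp_div hs.ne')
    exact h.const_mul _

theorem fourierHat_conj_kernel {ψ : ℝ → ℂ} (hψ : IsAnalyticWavelet ψ) {s : ℝ} (hs : 0 ≤ s)
    (l : ℝ) :
    fourierHat (fun t => (starRingEnd ℂ) (kernel ψ s t)) l = fourierHat ψ (s * l) := by
  rcases hs.eq_or_lt with rfl | hs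
  -- At $s=0$ the convention $1/0=0$ makes the kernel zero, in agreement with $\widehat\psi(0)=0$,
  -- so the scaling formula includes the endpoint.
  · rw [zero_mul, hψ.fourierHat_eq_zero 0 le_rfl]
    simp [kernel, fourierHat]
  · have h := Measure.integral_comp_div
      (fun t : ℝ => Complex.exp (-(Complex.I * (t : ℂ) * ((s * l : ℝ) : ℂ))) * ψ t) s
    rw [abs_of_pos hs] at h
    have h2 : ((s : ℂ))⁻¹ * ((s : ℂ) * fourierHat ψ (s * l)) = fourierHat ψ (s * l) := by
      rw [← mul_assoc, inv_mul_cancel₀ (by exact_mod_cast hs.ne'), one_mul]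
    rw [← h2]
    have h3 : (s : ℂ) * fourierHat ψ (s * l) =
      s • ∫ t : ℝ, Complex.exp (-(Complex.I * (t : ℂ) * ((s * l : ℝ) : ℂ))) * ψ t := by
      rw [Complex.real_smul, fourierHat]
    rw [h3, ← h, ← integral_const_mul, fourierHat]
    congr 1; ext t
    have hs' : (s : ℂ) ≠ 0 := by exact_mod_cast hs.ne'
    have h5 : Complex.I * ((t / s : ℝ) : ℂ) * ((s * l : ℝ) : ℂ) = Complex.I * t * l := by
      push_cast; field_simp
    rw [h5]
    simp only [kernel, map_mul, Complex.conj_conj, Complex.conj_ofReal]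
    push_cast
    ring

theorem integral_kernel {ψ : ℝ → ℂ} (hψ : IsAnalyticWavelet ψ) {s : ℝ} (hs : 0 ≤ s) :
    ∫ t, kernel ψ s t = 0 := by
  have h := conj_fourierHat_conj (kernel ψ s) 0
  rw [fourierHat_conj_kernel hψ hs, mul_zero, hψ.fourierHat_eq_zero 0 le_rfl, map_zero] at h
  simpa using h.symm

/-- The kernel has integral $0$, so the constant mean of $\Phi$ is invisible to the transform and
the process may be centred. -/
theorem awtNoise_ae_eq (hΦ : IsGaussianNoise P Φ p)
    (hm : Measurable (fun q : ℝ × Ω => Φ q.1 q.2)) {ψ : ℝ → ℂ} (hψ : IsAnalyticWavelet ψ)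
    {s : ℝ} (hs : 0 ≤ s) :
    ∀ᵐ ω ∂P, awtNoise ψ Φ s ω = ∫ t, kernel ψ s t * centred P Φ t ω := by
  have hk := integrable_kernel hψ.integrable hs
  filter_upwards [ae_integrable_weight (hΦ.measurable_centred hm) hΦ.memLp_centred
    (fun t => (hΦ.integral_sq_centred t).le) hk] with ω hω
  have h : ∀ t, ((Φ t ω : ℝ) : ℂ) * ((1 / s : ℝ) : ℂ) * (starRingEnd ℂ) (ψ ((t - 0) / s)) =
      kernel ψ s t * centred P Φ t ω + kernel ψ s t * ((∫ x, Φ 0 x ∂P : ℝ) : ℂ) := by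
    intro t
    simp only [kernel, centred, hΦ.mean_eq t, sub_zero]
    push_cast; ring
  simp only [awtNoise, awt, h]
  rw [integral_add hω (hk.mul_const _), integral_mul_const, integral_kernel hψ hs, zero_mul,
    add_zero]

/-- Supplies the base point of the chaining: the second moment at $s$ becomes the squared distance
from $s$ to $0$. -/
theorem awtNoise_zero (ψ : ℝ → ℂ) (Φ : ℝ → Ω → ℝ) (ω : Ω) : awtNoise ψ Φ 0 ω = 0 := by
  simp [awtNoise, awt]

theorem aestronglyMeasurable_awtNoise (hΦ : IsGaussianNoise P Φ p)
    (hm : Measurable (fun q : ℝ × Ω => Φ q.1 q.2)) {ψ : ℝ → ℂ} (hψ : IsAnalyticWavelet ψ)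
    {s : ℝ} (hs : 0 ≤ s) : AEStronglyMeasurable (awtNoise ψ Φ s) P :=
  (memLp_weight (hΦ.measurable_centred hm) hΦ.memLp_centred
    (fun t => (hΦ.integral_sq_centred t).le)
    (integrable_kernel hψ.integrable hs)).aestronglyMeasurable.congr
    (EventuallyEq.symm (awtNoise_ae_eq hΦ hm hψ hs))

/-- The squared canonical distance `∫ p(λ) |ψ̂(sλ) - ψ̂(tλ)|² dλ`. -/
noncomputable def distSq (p : ℝ → ℝ) (ψ : ℝ → ℂ) (s t : ℝ) : ℝ :=
  ∫ l, p l * ‖fourierHat ψ (s * l) - fourierHat ψ (t * l)‖ ^ 2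

theorem awtNoise_sub_ae_eq (hΦ : IsGaussianNoise P Φ p)
    (hm : Measurable (fun q : ℝ × Ω => Φ q.1 q.2)) {ψ : ℝ → ℂ} (hψ : IsAnalyticWavelet ψ)
    {s t : ℝ} (hs : 0 ≤ s) (ht : 0 ≤ t) :
    ∀ᵐ ω ∂P, awtNoise ψ Φ s ω - awtNoise ψ Φ t ω =
      ∫ u, (kernel ψ s u - kernel ψ t u) * centred P Φ u ω := by
  have hi := fun {s : ℝ} (hs : 0 ≤ s) => ae_integrable_weight (hΦ.measurable_centred hm)
    hΦ.memLp_centred (fun t => (hΦ.integral_sq_centred t).le)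
    (integrable_kernel hψ.integrable hs)
  filter_upwards [awtNoise_ae_eq hΦ hm hψ hs, awtNoise_ae_eq hΦ hm hψ ht, hi hs, hi ht]
    with ω h1 h2 h3 h4
  simp only [sub_mul]
  rw [h1, h2, integral_sub h3 h4]

theorem integral_sq_awtNoise_sub (hΦ : IsGaussianNoise P Φ p)
    (hm : Measurable (fun q : ℝ × Ω => Φ q.1 q.2)) {ψ : ℝ → ℂ} (hψ : IsAnalyticWavelet ψ)
    {s t : ℝ} (hs : 0 ≤ s) (ht : 0 ≤ t) :
    ∫ ω, ‖∫ u, (kernel ψ s u - kernel ψ t u) * centred P Φ u ω‖ ^ 2 ∂P = distSq p ψ s t := by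
  have hks := integrable_kernel hψ.integrable hs
  have hkt := integrable_kernel hψ.integrable ht
  have h := hΦ.integral_sq_weight hm (hks.sub hkt)
  simp only [Pi.sub_apply] at h
  rw [h, distSq]
  congr 1; ext l
  congr 3
  rw [← fourierHat_conj_kernel hψ hs, ← fourierHat_conj_kernel hψ ht, fourierHat_eq, fourierHat_eq,
    fourierHat_eq, ← integral_sub]
  · congr 1; ext u
    rw [map_sub, mul_sub]
  all_goals
    refine Integrable.bdd_mul (c := 1)
      ((LinearIsometryEquiv.integrable_comp_iff Complex.conjLIE).2 (by assumption))
      (Continuous.aestronglyMeasurable (by fun_prop))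
      (ae_of_all _ fun t => (norm_exp_mul_eq_one (by simp) t l).le)

theorem lintegral_exp_awtNoise_sub_le (hΦ : IsGaussianNoise P Φ p)
    (hm : Measurable (fun q : ℝ × Ω => Φ q.1 q.2)) {ψ : ℝ → ℂ} (hψ : IsAnalyticWavelet ψ)
    {s t : ℝ} (hs : 0 ≤ s) (ht : 0 ≤ t) (τ : ℝ) (hτ : 0 ≤ τ) :
    ∫⁻ ω, ENNReal.ofReal (Real.exp (τ * ‖awtNoise ψ Φ s ω - awtNoise ψ Φ t ω‖)) ∂P ≤
      ENNReal.ofReal (4 * Real.exp (τ ^ 2 * distSq p ψ s t)) := by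
  have h := lintegral_exp_norm_weight_le hΦ.gaussian (F := centred P Φ) (fun _ _ => rfl)
    (hΦ.measurable_centred hm) hΦ.memLp_centred (fun t => (hΦ.integral_sq_centred t).le)
    ((integrable_kernel hψ.integrable hs).sub (integrable_kernel hψ.integrable ht)) τ hτ
  simp only [Pi.sub_apply] at h
  rw [integral_sq_awtNoise_sub hΦ hm hψ hs ht] at h
  refine (lintegral_congr_ae ?_).trans_le h
  filter_upwards [awtNoise_sub_ae_eq hΦ hm hψ hs ht] with ω hω
  rw [hω]

theorem secondMoment_eq (hΦ : IsGaussianNoise P Φ p)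
    (hm : Measurable (fun q : ℝ × Ω => Φ q.1 q.2)) {ψ : ℝ → ℂ} (hψ : IsAnalyticWavelet ψ)
    {s : ℝ} (hs : 0 ≤ s) : secondMoment P ψ Φ s = distSq p ψ s 0 := by
  rw [← integral_sq_awtNoise_sub hΦ hm hψ hs le_rfl, secondMoment]
  refine integral_congr_ae ?_
  filter_upwards [awtNoise_sub_ae_eq hΦ hm hψ hs le_rfl] with ω hω
  rw [← hω, awtNoise_zero, sub_zero]

end Noise

/-! ### Square integrability, boundedness and Lipschitz control of $\widehat\psi$ -/

open FourierTransform SchwartzMap in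
/-- The Fourier integral of `ψ ∈ L¹ ∩ L²` is square integrable. -/
theorem memLp_fourierIntegral {ψ : ℝ → ℂ} (h1 : Integrable ψ) (h2 : MemLp ψ 2) :
    MemLp (𝓕 ψ) 2 := by
  set L : Lp ℂ 2 (volume : Measure ℝ) := h2.toLp ψ with hL
  -- The Plancherel transform of the $L^2$ class and the Fourier integral agree almost everywhere,
  -- because they have the same pairing with every smooth compactly supported function: both
  -- transforms can be moved onto the test function.
  refine (memLp_congr_ae ?_).1 (Lp.memLp (𝓕 L))
  have hcont : Continuous (𝓕 ψ) :=
    VectorFourier.fourierIntegral_continuous Real.continuous_fourierChar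
      (by exact continuous_inner) h1
  refine ae_eq_of_integral_contDiff_smul_eq
    ((Lp.memLp (𝓕 L)).locallyIntegrable (by norm_num)) hcont.locallyIntegrable ?_
  intro g hg hgs
  have hgs' : HasCompactSupport (Complex.ofRealCLM ∘ g) := hgs.comp_left rfl
  set φ : 𝓢(ℝ, ℂ) := hgs'.toSchwartzMap (Complex.ofRealCLM.contDiff.comp hg) with hφ
  have hφg : ∀ x, φ x = ((g x : ℝ) : ℂ) := fun x => rfl
  have e1 : ∫ x, g x • (𝓕 L : Lp ℂ 2 (volume : Measure ℝ)) x =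
      ∫ x, (𝓕 φ) x • L x := by
    have := congrArg (fun T => T φ) (Lp.fourier_toTemperedDistribution_eq L)
    simp only [TemperedDistribution.fourier_apply, Lp.toTemperedDistribution_apply] at this
    rw [this]
    simp only [hφg, Complex.real_smul, smul_eq_mul]
  have e2 : ∫ x, (𝓕 φ) x • L x = ∫ x, (𝓕 φ) x • ψ x := by
    refine integral_congr_ae ?_
    filter_upwards [h2.coeFn_toLp] with x hx
    rw [hL, hx]
  have e3 : ∫ x, (𝓕 φ) x • ψ x = ∫ x, φ x • (𝓕 ψ) x := by
    have := VectorFourier.integral_fourierIntegral_smul_eq_flip (L := innerₗ ℝ)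
      (μ := volume) (ν := volume) (f := φ) (g := ψ) Real.continuous_fourierChar
      (by exact continuous_inner) φ.integrable h1
    simpa [SchwartzMap.fourier_coe, Real.fourier_eq, VectorFourier.fourierIntegral, real_inner_comm] using this
  rw [e1, e2, e3]
  simp only [hφg, Complex.real_smul, smul_eq_mul]

theorem fourierHat_eq_fourierIntegral (ψ : ℝ → ℂ) (w : ℝ) :
    fourierHat ψ w = FourierTransform.fourier ψ (w / (2 * Real.pi)) := by
  rw [Real.fourier_eq', fourierHat]
  congr 1; ext t
  rw [smul_eq_mul]
  congr 2
  have : (Real.pi : ℂ) ≠ 0 := by exact_mod_cast Real.pi_ne_zero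
  simp only [RCLike.inner_apply, conj_trivial]
  push_cast; field_simp

theorem integrable_sq_fourierHat {ψ : ℝ → ℂ} (hψ : IsAnalyticWavelet ψ) :
    Integrable fun w => ‖fourierHat ψ w‖ ^ 2 := by
  have h := memLp_fourierIntegral hψ.integrable hψ.memLp_two
  have h2 := (memLp_two_iff_integrable_sq_norm h.aestronglyMeasurable).1 h
  have h3 := h2.comp_div (R := 2 * Real.pi) (by positivity)
  simpa only [fourierHat_eq_fourierIntegral] using h3

section Fourier

variable {ψ : ℝ → ℂ}

theorem norm_fourierHat_le_supNorm (ψ : ℝ → ℂ) (w : ℝ) :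
    ‖fourierHat ψ w‖ ≤ supNorm (fourierHat ψ) :=
  le_ciSup (f := fun x => ‖fourierHat ψ x‖)
    ⟨∫ t, ‖ψ t‖, by rintro _ ⟨w, rfl⟩; exact norm_fourierHat_le ψ w⟩ w

theorem supNorm_nonneg (g : ℝ → ℂ) : 0 ≤ supNorm g := Real.iSup_nonneg fun _ => norm_nonneg _

theorem lipConst_nonneg (g : ℝ → ℂ) : 0 ≤ lipConst g := Real.iSup_nonneg fun _ => by positivity

theorem norm_sub_le_lipConst {g : ℝ → ℂ} (hg : ∃ K : NNReal, LipschitzOnWith K g (Ici 0))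
    {x y : ℝ} (hx : 0 ≤ x) (hy : 0 ≤ y) : ‖g x - g y‖ ≤ lipConst g * |x - y| := by
  obtain ⟨K, hK⟩ := hg
  rcases eq_or_ne x y with rfl | hxy
  · simp
  have hpos : 0 < |x - y| := abs_pos.2 (sub_ne_zero.2 hxy)
  rw [← div_le_iff₀ hpos]
  refine le_ciSup (f := fun q : Ici (0 : ℝ) × Ici (0 : ℝ) =>
    ‖g (q.1 : ℝ) - g (q.2 : ℝ)‖ / |(q.1 : ℝ) - (q.2 : ℝ)|) ⟨K, ?_⟩ (⟨x, hx⟩, ⟨y, hy⟩)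
  -- On the diagonal the quotient is $0/0=0$, so it respects the bound too.
  rintro _ ⟨q, rfl⟩
  refine div_le_of_le_mul₀ (abs_nonneg _) K.coe_nonneg ?_
  have := hK.dist_le_mul _ q.1.2 _ q.2.2
  rwa [dist_eq_norm, Real.dist_eq] at this

end Fourier

/-! ### Hölder bound and decay of the canonical distance -/

section Bounds

variable {p : ℝ → ℝ} {ψ : ℝ → ℂ}

theorem fourierHat_mul_eq_zero (hψ : IsAnalyticWavelet ψ) {s l : ℝ} (hs : 0 ≤ s) (hl : l ≤ 0) :
    fourierHat ψ (s * l) = 0 :=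
  hψ.fourierHat_eq_zero _ (mul_nonpos_of_nonneg_of_nonpos hs hl)

theorem integrable_distSq (hp : Integrable p) (hψ : IsAnalyticWavelet ψ) (s t : ℝ) :
    Integrable fun l => p l * ‖fourierHat ψ (s * l) - fourierHat ψ (t * l)‖ ^ 2 := by
  have hc := continuous_fourierHat hψ.integrable
  refine hp.mul_bdd (c := (2 * supNorm (fourierHat ψ)) ^ 2)
    (Continuous.aestronglyMeasurable (by fun_prop)) (ae_of_all _ fun l => ?_)
  rw [norm_pow, norm_norm]
  refine pow_le_pow_left₀ (norm_nonneg _) ((norm_sub_le _ _).trans ?_) 2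
  rw [two_mul]
  exact add_le_add (norm_fourierHat_le_supNorm ψ _)
    (norm_fourierHat_le_supNorm ψ _)

theorem distSq_nonneg (hp0 : ∀ l, 0 < p l) (s t : ℝ) : 0 ≤ distSq p ψ s t :=
  integral_nonneg fun l => mul_nonneg (hp0 l).le (sq_nonneg _)

theorem distSq_eq_setIntegral (hψ : IsAnalyticWavelet ψ) {s t : ℝ} (hs : 0 ≤ s) (ht : 0 ≤ t) :
    distSq p ψ s t =
      ∫ l in Ioi 0, p l * ‖fourierHat ψ (s * l) - fourierHat ψ (t * l)‖ ^ 2 := by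
  rw [distSq, setIntegral_eq_integral_of_forall_compl_eq_zero]
  intro l hl
  have hl' : l ≤ 0 := not_lt.1 hl
  simp [fourierHat_mul_eq_zero hψ hs hl', fourierHat_mul_eq_zero hψ ht hl']

theorem distSq_zero_right (hψ : IsAnalyticWavelet ψ) (s : ℝ) :
    distSq p ψ s 0 = ∫ l, p l * ‖fourierHat ψ (s * l)‖ ^ 2 := by
  simp only [distSq, zero_mul, hψ.fourierHat_eq_zero 0 le_rfl, sub_zero]

theorem distSq_zero_le (hp0 : ∀ l, 0 < p l) (hp : Integrable p) (hψ : IsAnalyticWavelet ψ)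
    (s : ℝ) : distSq p ψ s 0 ≤ (∫ l, p l) * supNorm (fourierHat ψ) ^ 2 := by
  have h := integrable_distSq hp hψ s 0
  simp only [zero_mul, hψ.fourierHat_eq_zero 0 le_rfl, sub_zero] at h
  rw [distSq_zero_right hψ, ← integral_mul_const]
  refine integral_mono h (hp.mul_const _) fun l => ?_
  exact mul_le_mul_of_nonneg_left (pow_le_pow_left₀ (norm_nonneg _)
    (norm_fourierHat_le_supNorm ψ _) 2) (hp0 l).le

/-- Analyticity leaves only $\lambda>0$, where the increment of $\widehat\psi$ is at most
$\min(N,q\lambda)$ with $N=2\|\widehat\psi\|_\infty$ and $q=\|\widehat\psi\|_{\mathrm{Lip}}|s-t|$.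
Against $C_1\lambda^{-1-\gamma}$, cutting at the crossover $\lambda=N/q$ gives
$N^{2-\gamma}q^\gamma$ times $C_1/(2-\gamma)$ below and $C_1/\gamma$ above. -/
theorem distSq_le_rpow (hpi : Integrable p) {γ C₁ : ℝ}
    (hp : HighFrequencyDecay p γ C₁) (hψ : IsAnalyticWavelet ψ)
    (hlip : ∃ K : NNReal, LipschitzOnWith K (fourierHat ψ) (Ici 0)) {s t : ℝ} (hs : 0 ≤ s)
    (ht : 0 ≤ t) :
    distSq p ψ s t ≤ C₁ * (1 / γ + 1 / (2 - γ)) * (2 * supNorm (fourierHat ψ)) ^ (2 - γ)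
        * lipConst (fourierHat ψ) ^ γ * |s - t| ^ γ := by
  have hγ := hp.gamma_pos
  have hγ2 : 0 < 2 - γ := by linarith [hp.gamma_lt_two]
  have hC := hp.const_pos
  set f := fourierHat ψ with hf
  set M := supNorm f with hM
  set K := lipConst f with hK
  have hM0 : 0 ≤ M := supNorm_nonneg _
  have hK0 : 0 ≤ K := lipConst_nonneg _
  set N := 2 * M with hN
  set q := K * |s - t| with hq
  have hN0 : 0 ≤ N := by positivity
  have hq0 : 0 ≤ q := by positivity
  have hdN : ∀ l, ‖f (s * l) - f (t * l)‖ ≤ N := fun l =>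
    (norm_sub_le _ _).trans (by
      rw [hN, two_mul]
      exact add_le_add (norm_fourierHat_le_supNorm ψ _)
        (norm_fourierHat_le_supNorm ψ _))
  have hdq : ∀ l, 0 < l → ‖f (s * l) - f (t * l)‖ ≤ q * l := fun l hl => by
    refine (norm_sub_le_lipConst hlip (by positivity) (by positivity)).trans_eq ?_
    rw [← sub_mul, abs_mul, abs_of_pos hl, ← mul_assoc]
  have hrhs : C₁ * (1 / γ + 1 / (2 - γ)) * N ^ (2 - γ) * K ^ γ * |s - t| ^ γ =
      C₁ * (1 / γ + 1 / (2 - γ)) * (N ^ (2 - γ) * q ^ γ) := by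
    rw [hq, Real.mul_rpow hK0 (abs_nonneg _)]; ring
  rw [hrhs, distSq_eq_setIntegral hψ hs ht]
  have hint := integrable_distSq hpi hψ s t
  -- The crossover point $N/q$ needs both quantities positive; otherwise the integrand vanishes on
  -- $\lambda>0$.
  by_cases h0 : N = 0 ∨ q = 0
  · have hz : ∀ l ∈ Ioi (0 : ℝ), p l * ‖f (s * l) - f (t * l)‖ ^ 2 = 0 := fun l hl => by
      have h1 : ‖f (s * l) - f (t * l)‖ ≤ 0 := by
        rcases h0 with h | h
        · exact h ▸ hdN l
        · simpa [h] using hdq l hl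
      have h2 := le_antisymm h1 (norm_nonneg _)
      simp [h2]
    rw [setIntegral_congr_fun measurableSet_Ioi hz]
    simp only [integral_zero]
    positivity
  push Not at h0
  have hNpos : 0 < N := lt_of_le_of_ne hN0 (Ne.symm h0.1)
  have hqpos : 0 < q := lt_of_le_of_ne hq0 (Ne.symm h0.2)
  set A := N / q with hA
  have hApos : 0 < A := by positivity
  rw [← Ioc_union_Ioi_eq_Ioi hApos.le,
    setIntegral_union (Ioc_disjoint_Ioi le_rfl) measurableSet_Ioi hint.integrableOn
      hint.integrableOn]
  have hb : ∀ l, 0 < l → p l ≤ C₁ * l ^ (-(1 + γ)) := fun l hl => by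
    simpa [abs_of_pos hl] using hp.bound l hl.ne'
  -- low frequencies
  have hlow_int : IntervalIntegrable (fun l : ℝ => l ^ (1 - γ)) volume 0 A :=
    intervalIntegral.intervalIntegrable_rpow' (by linarith)
  have hlow : ∫ l in Ioc 0 A, p l * ‖f (s * l) - f (t * l)‖ ^ 2 ≤
      C₁ * (1 / (2 - γ)) * (N ^ (2 - γ) * q ^ γ) := by
    calc _ ≤ ∫ l in Ioc 0 A, C₁ * q ^ 2 * l ^ (1 - γ) := by
          refine setIntegral_mono_on hint.integrableOn (hlow_int.1.const_mul _)
            measurableSet_Ioc fun l hl => ?_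
          have h1 : l ^ (1 - γ) = l ^ (-(1 + γ)) * l ^ 2 := by
            rw [← Real.rpow_natCast, ← Real.rpow_add hl.1]; congr 1; push_cast; ring
          calc p l * ‖f (s * l) - f (t * l)‖ ^ 2
              ≤ (C₁ * l ^ (-(1 + γ))) * (q * l) ^ 2 :=
                mul_le_mul (hb l hl.1) (pow_le_pow_left₀ (norm_nonneg _) (hdq l hl.1) 2)
                  (by positivity) (mul_nonneg hC.le (Real.rpow_nonneg hl.1.le _))
            _ = _ := by rw [h1]; ring
      _ = C₁ * q ^ 2 * (A ^ (2 - γ) / (2 - γ)) := by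
          rw [integral_const_mul, ← intervalIntegral.integral_of_le hApos.le,
            integral_rpow (Or.inl (by linarith))]
          rw [show 1 - γ + 1 = 2 - γ by ring, Real.zero_rpow hγ2.ne', sub_zero]
      _ = _ := by
          rw [hA, Real.div_rpow hN0 hq0]
          have h2 : q ^ γ * q ^ (2 - γ) = q ^ 2 := by
            rw [← Real.rpow_add hqpos, ← Real.rpow_natCast]; congr 1; push_cast; ring
          rw [← h2]
          have := (Real.rpow_pos_of_pos hqpos (2 - γ)).ne'
          field_simp
  -- high frequencies
  have hhigh_int : IntegrableOn (fun l : ℝ => l ^ (-(1 + γ))) (Ioi A) :=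
    integrableOn_Ioi_rpow_of_lt (by linarith) hApos
  have hhigh : ∫ l in Ioi A, p l * ‖f (s * l) - f (t * l)‖ ^ 2 ≤
      C₁ * (1 / γ) * (N ^ (2 - γ) * q ^ γ) := by
    calc _ ≤ ∫ l in Ioi A, C₁ * N ^ 2 * l ^ (-(1 + γ)) := by
          refine setIntegral_mono_on hint.integrableOn (hhigh_int.const_mul _)
            measurableSet_Ioi fun l hl => ?_
          have hl0 : 0 < l := hApos.trans hl
          calc p l * ‖f (s * l) - f (t * l)‖ ^ 2
              ≤ (C₁ * l ^ (-(1 + γ))) * N ^ 2 :=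
                mul_le_mul (hb l hl0) (pow_le_pow_left₀ (norm_nonneg _) (hdN l) 2)
                  (by positivity) (mul_nonneg hC.le (Real.rpow_nonneg hl0.le _))
            _ = _ := by ring
      _ = C₁ * N ^ 2 * (A ^ (-γ) / γ) := by
          rw [integral_const_mul, integral_Ioi_rpow_of_lt (by linarith) hApos]
          rw [show -(1 + γ) + 1 = -γ by ring, neg_div_neg_eq]
      _ = _ := by
          rw [hA, Real.div_rpow hN0 hq0, Real.rpow_neg hq0]
          have h2 : N ^ (2 - γ) = N ^ 2 * N ^ (-γ) := by
            rw [← Real.rpow_natCast, ← Real.rpow_add hNpos]; congr 1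
          rw [h2]
          have := (Real.rpow_pos_of_pos hqpos γ).ne'
          field_simp
  calc _ ≤ _ := add_le_add hlow hhigh
    _ = _ := by ring

/-! ### Decay at large scales -/

/-- Substituting $u=s\lambda$ turns the term $\lambda^{a-1}$ into $s^{-a}$ and the constant into
$s^{-1}\le s^{-a}$. The resulting integrals are finite because $\widehat\psi$ is bounded near $0$,
where $u^{a-1}$ is integrable, and square integrable at infinity, where $u^{a-1}\le1$. -/
theorem exists_distSq_le_of_density_le (hpi : Integrable p)
    (hψ : IsAnalyticWavelet ψ) {a A B : ℝ} (ha : 0 < a) (ha1 : a ≤ 1)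
    (hB : 0 ≤ B) (hp : ∀ l, 0 < l → p l ≤ A * l ^ (a - 1) + B) :
    ∃ C, ∀ s, 1 ≤ s → distSq p ψ s 0 ≤ C * s ^ (-a) := by
  set f := fourierHat ψ with hf
  set M := supNorm f with hM
  have hM0 : 0 ≤ M := supNorm_nonneg _
  have hf2 : Integrable fun w => ‖f w‖ ^ 2 := integrable_sq_fourierHat hψ
  have hfM : ∀ w, ‖f w‖ ^ 2 ≤ M ^ 2 := fun w =>
    pow_le_pow_left₀ (norm_nonneg _) (norm_fourierHat_le_supNorm ψ w) 2
  have hfc : Continuous f := continuous_fourierHat hψ.integrable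
  have hw : IntegrableOn (fun u : ℝ => u ^ (a - 1) * ‖f u‖ ^ 2) (Ioi 0) := by
    rw [← Ioc_union_Ioi_eq_Ioi zero_le_one]
    refine IntegrableOn.union ?_ ?_
    · have h1 : IntervalIntegrable (fun l : ℝ => l ^ (a - 1)) volume 0 1 :=
        intervalIntegral.intervalIntegrable_rpow' (by linarith)
      refine Integrable.mul_bdd (c := M ^ 2) h1.1
        (Continuous.aestronglyMeasurable (by fun_prop)) (ae_of_all _ fun u => ?_)
      rw [Real.norm_of_nonneg (by positivity)]
      exact hfM u
    · refine Integrable.mono' hf2.integrableOn ?_ ?_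
      · exact (Measurable.aestronglyMeasurable (by fun_prop)).mul
          (Continuous.aestronglyMeasurable (by fun_prop))
      · refine (ae_restrict_iff' measurableSet_Ioi).2 (ae_of_all _ fun u hu => ?_)
        have hu1 : (1 : ℝ) < u := hu
        rw [Real.norm_of_nonneg (by positivity)]
        refine mul_le_of_le_one_left (by positivity) ?_
        exact Real.rpow_le_one_of_one_le_of_nonpos hu1.le (by linarith)
  set I := ∫ u in Ioi (0 : ℝ), u ^ (a - 1) * ‖f u‖ ^ 2 with hI
  set J := ∫ u in Ioi (0 : ℝ), ‖f u‖ ^ 2 with hJ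
  have hJ0 : 0 ≤ J := integral_nonneg fun _ => by positivity
  refine ⟨A * I + B * J, fun s hs => ?_⟩
  have hs0 : 0 < s := zero_lt_one.trans_le hs
  have hint := integrable_distSq hpi hψ s 0
  rw [distSq_eq_setIntegral hψ hs0.le le_rfl]
  simp only [zero_mul, hψ.fourierHat_eq_zero 0 le_rfl, sub_zero] at hint ⊢
  have e1 : ∀ l : ℝ, 0 < l → l ^ (a - 1) * ‖f (s * l)‖ ^ 2 =
      s ^ (1 - a) * ((s * l) ^ (a - 1) * ‖f (s * l)‖ ^ 2) := fun l hl => by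
    rw [Real.mul_rpow hs0.le hl.le, ← mul_assoc, ← mul_assoc, ← Real.rpow_add hs0]
    simp
  have i1 : IntegrableOn (fun l : ℝ => (s * l) ^ (a - 1) * ‖f (s * l)‖ ^ 2) (Ioi 0) := by
    have := (integrableOn_Ioi_comp_mul_left_iff
      (fun u : ℝ => u ^ (a - 1) * ‖f u‖ ^ 2) 0 hs0).2 (by simpa using hw)
    exact this
  have i2 : IntegrableOn (fun l : ℝ => ‖f (s * l)‖ ^ 2) (Ioi 0) :=
    (integrableOn_Ioi_comp_mul_left_iff (fun u : ℝ => ‖f u‖ ^ 2) 0 hs0).2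
      (by simpa using hf2.integrableOn)
  have v1 : ∫ l in Ioi (0 : ℝ), (s * l) ^ (a - 1) * ‖f (s * l)‖ ^ 2 = s⁻¹ * I := by
    have := integral_comp_mul_left_Ioi (fun u : ℝ => u ^ (a - 1) * ‖f u‖ ^ 2) 0 hs0
    simpa using this
  have v2 : ∫ l in Ioi (0 : ℝ), ‖f (s * l)‖ ^ 2 = s⁻¹ * J := by
    have := integral_comp_mul_left_Ioi (fun u : ℝ => ‖f u‖ ^ 2) 0 hs0
    simpa using this
  calc ∫ l in Ioi 0, p l * ‖f (s * l)‖ ^ 2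
      ≤ ∫ l in Ioi 0, (A * s ^ (1 - a) * ((s * l) ^ (a - 1) * ‖f (s * l)‖ ^ 2)
          + B * ‖f (s * l)‖ ^ 2) := by
        refine setIntegral_mono_on hint.integrableOn ((i1.const_mul _).add (i2.const_mul _))
          measurableSet_Ioi fun l hl => ?_
        have := mul_le_mul_of_nonneg_right (hp l hl) (sq_nonneg ‖f (s * l)‖)
        rw [add_mul, mul_assoc, e1 l hl] at this
        linarith
    _ = A * s ^ (1 - a) * (s⁻¹ * I) + B * (s⁻¹ * J) := by
        rw [integral_add (i1.const_mul _) (i2.const_mul _), integral_const_mul,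
          integral_const_mul, v1, v2]
    _ = A * I * s ^ (-a) + B * J * s ^ (-1 : ℝ) := by
        have : s ^ (-a) = s ^ (1 - a) * s⁻¹ := by
          rw [← Real.rpow_neg_one, ← Real.rpow_add hs0]; congr 1; ring
        rw [this, Real.rpow_neg_one]; ring
    _ ≤ A * I * s ^ (-a) + B * J * s ^ (-a) := by
        have : s ^ (-1 : ℝ) ≤ s ^ (-a) := Real.rpow_le_rpow_of_exponent_le hs (by linarith)
        gcongr
    _ = _ := by ring

/-- An upper Potter bound for slowly varying functions. -/
theorem IsSlowlyVarying.exists_le_rpow {L : ℝ → ℝ} (hL : IsSlowlyVarying L) {η : ℝ}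
    (hη : 0 < η) : ∃ C r₀ : ℝ, 0 < C ∧ 0 < r₀ ∧ ∀ r, r₀ ≤ r → L r ≤ C * r ^ η := by
  have h2 : (1 : ℝ) < 2 ^ η := Real.one_lt_rpow one_lt_two hη
  obtain ⟨r₁, hr₁⟩ := eventually_atTop.1
    ((hL.ratio_tendsto 2 two_pos).eventually (gt_mem_nhds h2))
  set r₀ := max r₁ 1 with hr₀
  have hr₀1 : 1 ≤ r₀ := le_max_right _ _
  have hr₀0 : 0 < r₀ := zero_lt_one.trans_le hr₀1
  obtain ⟨M, hM⟩ := hL.locally_bounded r₀ (2 * r₀) hr₀0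
  have hMpos : 0 < M := (hL.pos r₀ hr₀0).trans_le (hM r₀ ⟨le_rfl, by linarith⟩)
  -- Each doubling beyond $r_0$ multiplies $L$ by at most $2^\eta$, exactly the growth of $r^\eta$.
  -- Halving $r$ until it falls in $[r_0,2r_0]$ reduces to the local bound $M$.
  have key : ∀ n : ℕ, ∀ r, r₀ ≤ r → r ≤ 2 ^ n * (2 * r₀) → L r ≤ M * r ^ η := by
    intro n
    induction n with
    | zero =>
      intro r h1 h3
      refine (hM r ⟨h1, by simpa using h3⟩).trans ?_
      exact le_mul_of_one_le_right hMpos.le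
        (Real.one_le_rpow (hr₀1.trans h1) hη.le)
    | succ n ih =>
      intro r h1 h3
      rcases le_total r (2 * r₀) with h4 | h4
      · refine (hM r ⟨h1, h4⟩).trans ?_
        exact le_mul_of_one_le_right hMpos.le
          (Real.one_le_rpow (hr₀1.trans h1) hη.le)
      · have h5 : r₀ ≤ r / 2 := by linarith
        have h6 := ih (r / 2) h5 (by rw [pow_succ] at h3; linarith)
        have hpos : 0 < L (r / 2) := hL.pos _ (hr₀0.trans_le h5)
        have h7 := hr₁ (r / 2) ((le_max_left _ _).trans h5)
        rw [mul_div_cancel₀ r two_ne_zero, div_lt_iff₀ hpos] at h7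
        calc L r ≤ 2 ^ η * L (r / 2) := h7.le
          _ ≤ 2 ^ η * (M * (r / 2) ^ η) := by gcongr
          _ = M * r ^ η := by
            rw [Real.div_rpow (by linarith) two_pos.le]
            field_simp
  refine ⟨M, r₀, hMpos, hr₀0, fun r hr => ?_⟩
  obtain ⟨n, hn⟩ := pow_unbounded_of_one_lt r one_lt_two
  exact key n r hr (hn.le.trans (le_mul_of_one_le_right (by positivity) (by linarith)))

/-- Brings both dependence regimes to one form. Under long-range dependence the Potter bound with
loss $(H-h)/2$ leaves $a=(H+h)/2>h$ near $0$, while the high-frequency bound supplies the constant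
elsewhere; under short-range dependence $a=1$. Strictness of $h<a$ lets a power of $s$ absorb the
constant later. -/
theorem exists_density_le {γ C₁ : ℝ} (hp : HighFrequencyDecay p γ C₁) {h : ℝ} (hh : 0 < h)
    (hh1 : h < 1)
    (hdep : (∃ H : ℝ, LongRangeDependent p H ∧ h < H) ∨ (ShortRangeDependent p ∧ h ≤ 1)) :
    ∃ a A B : ℝ, h < a ∧ a ≤ 1 ∧ 0 ≤ B ∧ ∀ l, 0 < l → p l ≤ A * l ^ (a - 1) + B := by
  rcases hdep with ⟨H, ⟨_, hH1, L, hL, hpL⟩, hhH⟩ | ⟨⟨⟨M, hM⟩, _⟩, _⟩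
  · obtain ⟨C, r₀, hC, hr₀, hLr⟩ := hL.exists_le_rpow (η := (H - h) / 2) (by linarith)
    have hC1 := hp.const_pos
    refine ⟨(H + h) / 2, C, C₁ * (r₀⁻¹) ^ (-(1 + γ)), by linarith, by linarith, by positivity, fun l hl => ?_⟩
    rcases le_total l r₀⁻¹ with h1 | h1
    · have h2 : r₀ ≤ l⁻¹ := (le_inv_comm₀ hl hr₀).1 h1
      refine le_add_of_le_of_nonneg ?_ (by positivity)
      rw [hpL l hl.ne', abs_of_pos hl]
      calc L l⁻¹ * l ^ (H - 1) ≤ (C * l⁻¹ ^ ((H - h) / 2)) * l ^ (H - 1) := by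
            gcongr; exact hLr _ h2
        _ = C * l ^ ((H + h) / 2 - 1) := by
            rw [Real.inv_rpow hl.le, ← Real.rpow_neg hl.le, mul_assoc, ← Real.rpow_add hl]
            congr 2; ring
    · refine le_add_of_nonneg_of_le (by positivity) ((hp.bound l hl.ne').trans ?_)
      rw [abs_of_pos hl]
      refine mul_le_mul_of_nonneg_left ?_ hC1.le
      exact Real.rpow_le_rpow_of_nonpos (by positivity) h1 (by linarith [hp.gamma_pos])
  · refine ⟨1, 0, max M 0, hh1, le_rfl, le_max_right _ _, fun l _ => ?_⟩
    rw [zero_mul, zero_add]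
    exact (hM l).trans (le_max_left _ _)

theorem exists_forall_distSq_le_rpow (hpi : Integrable p) {γ C₁ : ℝ}
    (hp : HighFrequencyDecay p γ C₁) (hψ : IsAnalyticWavelet ψ) {h : ℝ} (hh : 0 < h)
    (hh1 : h < 1)
    (hdep : (∃ H : ℝ, LongRangeDependent p H ∧ h < H) ∨ (ShortRangeDependent p ∧ h ≤ 1)) :
    ∃ T : ℝ, 0 < T ∧ ∀ s, T ≤ s → distSq p ψ s 0 ≤ s ^ (-h) := by
  obtain ⟨a, A, B, hha, ha1, hB, hpl⟩ := exists_density_le hp hh hh1 hdep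
  obtain ⟨C, hC⟩ := exists_distSq_le_of_density_le hpi hψ (hh.trans hha) ha1 hB hpl
  have ht : Tendsto (fun s : ℝ => s ^ (a - h)) atTop atTop :=
    tendsto_rpow_atTop (by linarith)
  obtain ⟨T, hT⟩ := eventually_atTop.1 (ht.eventually_ge_atTop C)
  refine ⟨max T 1, by positivity, fun s hs => ?_⟩
  have hs1 : 1 ≤ s := (le_max_right _ _).trans hs
  have hs0 : 0 < s := zero_lt_one.trans_le hs1
  calc distSq p ψ s 0 ≤ C * s ^ (-a) := hC s hs1
    _ ≤ s ^ (a - h) * s ^ (-a) := by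
      gcongr; exact hT s ((le_max_left _ _).trans hs)
    _ = s ^ (-h) := by rw [← Real.rpow_add hs0]; congr 1; ring

end Bounds

/-! ### Maximal inequality, chaining and nets -/

section Chaining

variable {Ω : Type*} [MeasurableSpace Ω] {P : Measure Ω} [IsProbabilityMeasure P]

/-- Maximal inequality for finitely many variables with Gaussian exponential moments. -/
theorem lintegral_iSup_le_of_exp {ι : Type*} {I : Finset ι} (hI : I.Nonempty) {Z : ι → Ω → ℂ}
    (hZ : ∀ i ∈ I, AEMeasurable (Z i) P) {r : ℝ} (hr : 0 < r)
    (h : ∀ i ∈ I, ∀ τ : ℝ, 0 ≤ τ → ∫⁻ ω, ENNReal.ofReal (Real.exp (τ * ‖Z i ω‖)) ∂P ≤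
      ENNReal.ofReal (4 * Real.exp (τ ^ 2 * r ^ 2))) {n : ℝ} (hn : (I.card : ℝ) ≤ n) :
    ∫⁻ ω, ⨆ i ∈ I, ‖Z i ω‖ₑ ∂P ≤ ENNReal.ofReal (2 * r * √(Real.log (4 * n))) := by
  have hc1 : (1 : ℝ) ≤ I.card := by exact_mod_cast hI.card_pos
  have hn1 : 1 ≤ n := hc1.trans hn
  set L := Real.log (4 * n) with hL
  have hL1 : 1 ≤ L := by
    rw [hL, Real.le_log_iff_exp_le (by positivity)]
    linarith [Real.exp_one_lt_d9]
  have hL0 : 0 < L := by linarith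
  have hsL : 0 < √L := Real.sqrt_pos.2 hL0
  set τ := √L / r with hτ
  have hτ0 : 0 < τ := by positivity
  have hτr : τ ^ 2 * r ^ 2 = L := by
    rw [hτ, div_pow, Real.sq_sqrt hL0.le]; field_simp
  set c := Real.exp (-(2 * L)) / τ with hc
  have hc0 : 0 ≤ c := by positivity
  -- The tangent line of $\exp$ at $2L$. With $\tau=\sqrt L/r$ and $e^L=4n$, the exponential terms
  -- sum in expectation to at most $1/\tau$, giving $2L/\tau=2r\sqrt L$ in total.
  have hpt : ∀ z : ℂ, ‖z‖ₑ ≤ ENNReal.ofReal ((2 * L - 1) / τ) +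
      ENNReal.ofReal c * ENNReal.ofReal (Real.exp (τ * ‖z‖)) := by
    intro z
    rw [← ENNReal.ofReal_mul hc0, ← ENNReal.ofReal_add (div_nonneg (by linarith) hτ0.le)
      (by positivity), ← ofReal_norm]
    refine ENNReal.ofReal_le_ofReal ?_
    have h1 := Real.add_one_le_exp (τ * ‖z‖ - 2 * L)
    have h2 : c * Real.exp (τ * ‖z‖) = Real.exp (τ * ‖z‖ - 2 * L) / τ := by
      rw [hc, sub_eq_neg_add, Real.exp_add]; ring
    rw [h2, ← add_div, le_div_iff₀ hτ0]
    linarith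
  have hme : ∀ i ∈ I, AEMeasurable (fun ω =>
      ENNReal.ofReal c * ENNReal.ofReal (Real.exp (τ * ‖Z i ω‖))) P := fun i hi =>
    (Real.measurable_exp.comp_aemeasurable ((hZ i hi).norm.const_mul τ)).ennreal_ofReal.const_mul _
  calc ∫⁻ ω, ⨆ i ∈ I, ‖Z i ω‖ₑ ∂P
      ≤ ∫⁻ ω, (ENNReal.ofReal ((2 * L - 1) / τ) +
        ∑ i ∈ I, ENNReal.ofReal c * ENNReal.ofReal (Real.exp (τ * ‖Z i ω‖))) ∂P := by
        refine lintegral_mono fun ω => iSup₂_le fun i hi => (hpt _).trans ?_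
        refine add_le_add le_rfl ?_
        exact Finset.single_le_sum
          (f := fun i => ENNReal.ofReal c * ENNReal.ofReal (Real.exp (τ * ‖Z i ω‖)))
          (fun _ _ => zero_le) hi
    _ = ENNReal.ofReal ((2 * L - 1) / τ) + ∑ i ∈ I, ENNReal.ofReal c *
        ∫⁻ ω, ENNReal.ofReal (Real.exp (τ * ‖Z i ω‖)) ∂P := by
        rw [lintegral_add_left measurable_const, lintegral_const, measure_univ, mul_one,
          lintegral_finsetSum' _ hme]
        simp only [lintegral_const_mul' _ _ ENNReal.ofReal_ne_top]
    _ ≤ ENNReal.ofReal ((2 * L - 1) / τ) + ∑ i ∈ I, ENNReal.ofReal c *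
        ENNReal.ofReal (4 * Real.exp L) := by
        gcongr with i hi
        have := h i hi τ hτ0.le
        rwa [hτr] at this
    _ = ENNReal.ofReal ((2 * L - 1) / τ + I.card * (c * (4 * Real.exp L))) := by
        rw [Finset.sum_const, nsmul_eq_mul, ← ENNReal.ofReal_mul hc0,
          ENNReal.ofReal_add (div_nonneg (by linarith) hτ0.le) (by positivity),
          ENNReal.ofReal_mul (Nat.cast_nonneg _), ENNReal.ofReal_natCast]
    _ ≤ _ := by
        refine ENNReal.ofReal_le_ofReal ?_
        have h1 : c * (4 * Real.exp L) = 1 / (n * τ) := by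
          have h3 : Real.exp (-(2 * L)) * Real.exp L = 1 / (4 * n) := by
            rw [← Real.exp_add, show -(2 * L) + L = -L by ring, Real.exp_neg, hL,
              Real.exp_log (by positivity), one_div]
          calc c * (4 * Real.exp L) = 4 * (Real.exp (-(2 * L)) * Real.exp L) / τ := by
                rw [hc]; ring
            _ = _ := by rw [h3]; field_simp
        have h2 : (I.card : ℝ) * (c * (4 * Real.exp L)) ≤ 1 / τ := by
          rw [h1]
          calc (I.card : ℝ) * (1 / (n * τ)) ≤ n * (1 / (n * τ)) := by gcongr
            _ = 1 / τ := by field_simp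
        calc (2 * L - 1) / τ + I.card * (c * (4 * Real.exp L)) ≤ (2 * L - 1) / τ + 1 / τ := by
              gcongr
          _ = 2 * (√L * √L) / τ := by rw [Real.mul_self_sqrt hL0.le]; ring
          _ = 2 * r * √L := by rw [hτ]; field_simp

/-- The increments of `X` on `[0, ∞)` have Gaussian exponential moments with respect to the
squared distance `D`. -/
structure ExpIncrements (P : Measure Ω) (X : ℝ → Ω → ℂ) (D : ℝ → ℝ → ℝ) : Prop where
  aemeasurable : ∀ s, 0 ≤ s → AEMeasurable (X s) P
  exp_le : ∀ s t, 0 ≤ s → 0 ≤ t → ∀ τ : ℝ, 0 ≤ τ →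
    ∫⁻ ω, ENNReal.ofReal (Real.exp (τ * ‖X s ω - X t ω‖)) ∂P ≤
      ENNReal.ofReal (4 * Real.exp (τ ^ 2 * D s t))

variable {X : ℝ → Ω → ℂ} {D : ℝ → ℝ → ℝ}

theorem ExpIncrements.lintegral_iSup_le (hX : ExpIncrements P X D) {ι : Type*} {I : Finset ι}
    (hI : I.Nonempty) {u v : ι → ℝ} (hu : ∀ i ∈ I, 0 ≤ u i) (hv : ∀ i ∈ I, 0 ≤ v i) {r : ℝ}
    (hr : 0 < r) (hD : ∀ i ∈ I, D (u i) (v i) ≤ r ^ 2) {n : ℝ} (hn : (I.card : ℝ) ≤ n) :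
    ∫⁻ ω, ⨆ i ∈ I, ‖X (u i) ω - X (v i) ω‖ₑ ∂P ≤
      ENNReal.ofReal (2 * r * √(Real.log (4 * n))) := by
  refine lintegral_iSup_le_of_exp (Z := fun i ω => X (u i) ω - X (v i) ω) hI
    (fun i hi => (hX.aemeasurable _ (hu i hi)).sub (hX.aemeasurable _ (hv i hi))) hr
    (fun i hi τ hτ => (hX.exp_le _ _ (hu i hi) (hv i hi) τ hτ).trans ?_) hn
  have := hD i hi
  gcongr

theorem ExpIncrements.lintegral_enorm_sub_le (hX : ExpIncrements P X D) {s t : ℝ} (hs : 0 ≤ s)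
    (ht : 0 ≤ t) {r : ℝ} (hr : 0 < r) (hD : D s t ≤ r ^ 2) :
    ∫⁻ ω, ‖X s ω - X t ω‖ₑ ∂P ≤ ENNReal.ofReal (4 * r) := by
  have h := hX.lintegral_iSup_le (I := {()}) (u := fun _ => s) (v := fun _ => t) (by simp)
    (fun _ _ => hs) (fun _ _ => ht) hr (fun _ _ => hD) (n := 1) (by simp)
  simp only [Finset.mem_singleton, iSup_const, mul_one] at h
  refine h.trans (ENNReal.ofReal_le_ofReal ?_)
  have h4 : √(Real.log 4) ≤ 2 := by
    rw [Real.sqrt_le_left two_pos.le]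
    have := Real.log_le_sub_one_of_pos (x := 4) (by norm_num)
    linarith
  nlinarith

/-- The chaining bound along a sequence of nets of `[0, ∞)`. -/
theorem ExpIncrements.chaining (hX : ExpIncrements P X D) (hX0 : ∀ ω, X 0 ω = 0)
    {N : ℕ → Finset ℝ} {π : ℕ → ℝ → ℝ} {ε n : ℕ → ℝ} (hε : ∀ k, 0 < ε k)
    (hε0 : Tendsto ε atTop (𝓝 0)) (hN0 : N 0 = {0}) (hNpos : ∀ k, ∀ t ∈ N k, 0 ≤ t)
    (hπ : ∀ k s, 0 ≤ s → π k s ∈ N k) (hD : ∀ k s, 0 ≤ s → D s (π k s) ≤ ε k ^ 2)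
    (hn : ∀ k, ((N (k + 1)).card : ℝ) ≤ n k) {B : ℝ}
    (hB : ∀ K, ∑ k ∈ Finset.range K, 2 * ε k * √(Real.log (4 * n k)) ≤ B)
    {F : Finset ℝ} (hF : ∀ s ∈ F, 0 ≤ s) :
    ∫⁻ ω, ⨆ s ∈ F, ‖X s ω‖ₑ ∂P ≤ ENNReal.ofReal B := by
  set M : ℕ → Ω → ENNReal := fun k ω => ⨆ t ∈ N (k + 1), ‖X t ω - X (π k t) ω‖ₑ with hM
  have hMm : ∀ k, AEMeasurable (M k) P := fun k => by
    refine AEMeasurable.biSup _ (N (k + 1)).countable_toSet fun t ht => ?_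
    have h0 := hNpos _ t ht
    exact ((hX.aemeasurable _ h0).sub
      (hX.aemeasurable _ (hNpos _ _ (hπ k t h0)))).enorm
  -- A link starts at $t\in N_{k+1}$ and its end $\pi_k t$ is determined by $t$. Each level
  -- therefore costs one maximum over $N_{k+1}$, not over pairs.
  have hchain : ∀ ω k, ∀ t ∈ N k, ‖X t ω‖ₑ ≤ ∑ j ∈ Finset.range k, M j ω := by
    intro ω k
    induction k with
    | zero =>
      intro t ht
      rw [hN0, Finset.mem_singleton] at ht
      simp [ht, hX0]
    | succ k ih =>
      intro t ht
      rw [Finset.sum_range_succ, add_comm]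
      calc ‖X t ω‖ₑ = ‖(X t ω - X (π k t) ω) + X (π k t) ω‖ₑ := by rw [sub_add_cancel]
        _ ≤ ‖X t ω - X (π k t) ω‖ₑ + ‖X (π k t) ω‖ₑ := enorm_add_le _ _
        _ ≤ _ := add_le_add (le_iSup₂ (f := fun t _ => ‖X t ω - X (π k t) ω‖ₑ) t ht)
          (ih _ (hπ k t (hNpos _ t ht)))
  -- The last link, from $s\in F$ to its net point, is bounded crudely by a sum over the finite set
  -- $F$; this error vanishes as $k\to\infty$.
  have hbound : ∀ k, ∫⁻ ω, ⨆ s ∈ F, ‖X s ω‖ₑ ∂P ≤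
      (∑ _s ∈ F, ENNReal.ofReal (4 * ε k)) + ENNReal.ofReal B := by
    intro k
    have hm : ∀ s ∈ F, AEMeasurable (fun ω => ‖X s ω - X (π k s) ω‖ₑ) P := fun s hs =>
      ((hX.aemeasurable _ (hF s hs)).sub
        (hX.aemeasurable _ (hNpos _ _ (hπ k s (hF s hs))))).enorm
    calc ∫⁻ ω, ⨆ s ∈ F, ‖X s ω‖ₑ ∂P
        ≤ ∫⁻ ω, (∑ s ∈ F, ‖X s ω - X (π k s) ω‖ₑ + ∑ j ∈ Finset.range k, M j ω) ∂P := by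
          refine lintegral_mono fun ω => iSup₂_le fun s hs => ?_
          calc ‖X s ω‖ₑ = ‖(X s ω - X (π k s) ω) + X (π k s) ω‖ₑ := by rw [sub_add_cancel]
            _ ≤ ‖X s ω - X (π k s) ω‖ₑ + ‖X (π k s) ω‖ₑ := enorm_add_le _ _
            _ ≤ _ := add_le_add (Finset.single_le_sum
                (f := fun s => ‖X s ω - X (π k s) ω‖ₑ) (fun _ _ => zero_le) hs)
              (hchain ω k _ (hπ k s (hF s hs)))
      _ = ∑ s ∈ F, ∫⁻ ω, ‖X s ω - X (π k s) ω‖ₑ ∂P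
          + ∑ j ∈ Finset.range k, ∫⁻ ω, M j ω ∂P := by
          rw [lintegral_add_left' (Finset.aemeasurable_fun_sum _ hm),
            lintegral_finsetSum' _ hm, lintegral_finsetSum' _ fun j _ => hMm j]
      _ ≤ (∑ _s ∈ F, ENNReal.ofReal (4 * ε k)) + ∑ j ∈ Finset.range k,
          ENNReal.ofReal (2 * ε j * √(Real.log (4 * n j))) := by
          refine add_le_add (Finset.sum_le_sum fun s hs => ?_) (Finset.sum_le_sum fun j _ => ?_)
          · exact hX.lintegral_enorm_sub_le (hF s hs) (hNpos _ _ (hπ k s (hF s hs))) (hε k)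
              (hD k s (hF s hs))
          · exact hX.lintegral_iSup_le (u := id) ⟨_, hπ (j + 1) 0 le_rfl⟩
              (fun t ht => hNpos _ t ht)
              (fun t ht => hNpos _ _ (hπ j t (hNpos _ t ht))) (hε j)
              (fun t ht => hD j t (hNpos _ t ht)) (hn j)
      _ ≤ _ := by
          refine add_le_add le_rfl ?_
          rw [← ENNReal.ofReal_sum_of_nonneg fun j _ => by have := hε j; positivity]
          exact ENNReal.ofReal_le_ofReal (hB k)
  have hlim : Tendsto (fun k => (∑ _s ∈ F, ENNReal.ofReal (4 * ε k)) + ENNReal.ofReal B) atTop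
      (𝓝 ((∑ _s ∈ F, ENNReal.ofReal (4 * 0)) + ENNReal.ofReal B)) :=
    (tendsto_finsetSum _ fun _ _ => ENNReal.tendsto_ofReal (hε0.const_mul 4)).add_const _
  simpa using ge_of_tendsto' hlim hbound

/-- A net of `[0, ∞)`, at scale `e ≤ 1`, for a distance which is Hölder continuous and decays at
infinity. -/
theorem exists_net {γ h C T : ℝ} (hγ : 0 < γ) (hh : 0 < h) (hC : 1 ≤ C)
    (hHol : ∀ s t, 0 ≤ s → 0 ≤ t → D s t ≤ C ^ 2 * |s - t| ^ γ)
    (hTail : ∀ s, T ≤ s → D s 0 ≤ s ^ (-h)) {e : ℝ} (he : 0 < e) (he1 : e ≤ 1) :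
    ∃ (N : Finset ℝ) (π : ℝ → ℝ), (∀ t ∈ N, 0 ≤ t) ∧ (∀ s, 0 ≤ s → π s ∈ N) ∧
      (∀ s, 0 ≤ s → D s (π s) ≤ e ^ 2) ∧
      (N.card : ℝ) ≤ 2 * (max 1 T * (e⁻¹) ^ (2 / h) * (C / e) ^ (2 / γ)) := by
  classical
  have hC0 : 0 < C := by linarith
  -- The mesh solves $C^2r^\gamma=e^2$. Beyond $S$, defined next, the tail bound gives $s^{-h}\le
  -- e^2$, so every such point is sent to $0$ and only $[0,S)$ needs a grid. The factor $2$ in the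
  -- count absorbs the extra grid point, since $S/r\ge1$.
  set r := (e / C) ^ (2 / γ) with hr
  set S := max 1 T * (e⁻¹) ^ (2 / h) with hS
  have hr0 : 0 < r := Real.rpow_pos_of_pos (by positivity) _
  have hpow1 : 1 ≤ (e⁻¹) ^ (2 / h) := Real.one_le_rpow ((one_le_inv₀ he).2 he1) (by positivity)
  have hS1 : 1 ≤ S := one_le_mul_of_one_le_of_one_le (le_max_left _ _) hpow1
  have hr1 : r ≤ 1 := Real.rpow_le_one (by positivity)
    ((div_le_one hC0).2 (he1.trans hC)) (by positivity)
  have hST : T ≤ S := (le_max_right 1 T).trans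
    (le_mul_of_one_le_right (zero_le_one.trans (le_max_left _ _)) hpow1)
  have hSe : (e⁻¹) ^ (2 / h) ≤ S :=
    le_mul_of_one_le_left (by positivity) (le_max_left _ _)
  refine ⟨(Finset.range (⌊S / r⌋₊ + 1)).image fun j : ℕ => r * j,
    fun s => if S ≤ s then 0 else r * ⌊s / r⌋₊, ?_, ?_, ?_, ?_⟩
  · intro t ht
    obtain ⟨j, -, rfl⟩ := Finset.mem_image.1 ht
    positivity
  · intro s hs
    rw [Finset.mem_image]
    dsimp only
    split_ifs with h1
    · exact ⟨0, by simp, by simp⟩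
    · refine ⟨⌊s / r⌋₊, ?_, rfl⟩
      rw [Finset.mem_range, Nat.lt_succ_iff]
      refine Nat.floor_le_floor ?_
      push Not at h1
      gcongr
  · intro s hs
    dsimp only
    split_ifs with h1
    · refine (hTail s (hST.trans h1)).trans ?_
      have hs1 : (e⁻¹) ^ (2 / h) ≤ s := hSe.trans h1
      calc s ^ (-h) ≤ ((e⁻¹) ^ (2 / h)) ^ (-h) :=
            Real.rpow_le_rpow_of_nonpos (by positivity) hs1 (by linarith)
        _ = e ^ 2 := by
            rw [← Real.rpow_mul (by positivity), show 2 / h * -h = -2 by field_simp,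
              Real.rpow_neg (by positivity), Real.inv_rpow he.le, inv_inv]
            norm_num
    · have h2 : |s - r * ⌊s / r⌋₊| ≤ r := by
        have h3 := Nat.floor_le (a := s / r) (by positivity)
        have h4 := (Nat.lt_floor_add_one (s / r)).le
        rw [le_div_iff₀ hr0] at h3
        rw [div_le_iff₀ hr0] at h4
        rw [abs_le]; constructor <;> nlinarith
      refine (hHol s _ hs (by positivity)).trans ?_
      calc C ^ 2 * |s - r * ⌊s / r⌋₊| ^ γ ≤ C ^ 2 * r ^ γ := by gcongr
        _ = e ^ 2 := by
          rw [hr, ← Real.rpow_mul (by positivity), div_mul_cancel₀ _ hγ.ne',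
            show (2 : ℝ) = ((2 : ℕ) : ℝ) by norm_num, Real.rpow_natCast]
          field_simp
  · have h1 : ((Finset.range (⌊S / r⌋₊ + 1)).image fun j : ℕ => r * (j : ℝ)).card
        ≤ ⌊S / r⌋₊ + 1 := Finset.card_image_le.trans (by simp)
    have h2 : ((⌊S / r⌋₊ + 1 : ℕ) : ℝ) ≤ S / r + 1 := by
      push_cast
      linarith [Nat.floor_le (a := S / r) (by positivity)]
    have h3 : 1 ≤ S / r := (one_le_div hr0).2 (hr1.trans hS1)
    have h4 : S / r = S * (C / e) ^ (2 / γ) := by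
      rw [hr, div_eq_mul_inv, ← Real.inv_rpow (by positivity), inv_div]
    rw [← h4]
    calc _ ≤ ((⌊S / r⌋₊ + 1 : ℕ) : ℝ) := by exact_mod_cast h1
      _ ≤ _ := by linarith

end Chaining

/-! ### The entropy sum and Dudley's bound -/

theorem two_mul_sqrt_log_le {γ h C T Δ : ℝ} (hγ : 0 < γ) (hγ2 : γ < 2) (hh : 0 < h)
    (hh1 : h ≤ 1) (hC : 1 ≤ C) (hΔ : 2 ≤ Δ) (k : ℕ) :
    2 * √(Real.log (4 * (2 * (max 1 T * ((Δ⁻¹ ^ k)⁻¹) ^ (2 / h) * (C / Δ⁻¹ ^ k) ^ (2 / γ))))) ≤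
      4 * ((k + 1) * (√(Real.log Δ) * √(1 / γ + 1 / h)) +
        (√(1 / γ * Real.log C) + √(Real.log (max 1 T)))) := by
  have hΔ0 : 0 < Δ := by linarith
  have hC0 : 0 < C := by linarith
  have hM0 : 0 < max 1 T := zero_lt_one.trans_le (le_max_left _ _)
  have hlΔ : Real.log 2 ≤ Real.log Δ := Real.log_le_log two_pos hΔ
  have hl2 : 0 < Real.log 2 := Real.log_pos one_lt_two
  have hlC : 0 ≤ Real.log C := Real.log_nonneg hC
  have hlM : 0 ≤ Real.log (max 1 T) := Real.log_nonneg (le_max_left _ _)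
  have hγ' : 1 / 2 ≤ 1 / γ := one_div_le_one_div_of_le hγ hγ2.le
  have hh' : 1 ≤ 1 / h := (one_le_div hh).2 hh1
  set a := √(Real.log Δ) * √(1 / γ + 1 / h) with ha
  set b := √(1 / γ * Real.log C) with hb
  set c := √(Real.log (max 1 T)) with hc
  have ha2 : a ^ 2 = Real.log Δ * (1 / γ + 1 / h) := by
    rw [ha, mul_pow, Real.sq_sqrt (by linarith), Real.sq_sqrt (by linarith)]
  have hb2 : b ^ 2 = 1 / γ * Real.log C := Real.sq_sqrt (by positivity)
  have hc2 : c ^ 2 = Real.log (max 1 T) := Real.sq_sqrt hlM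
  have ha0 : 0 ≤ a := by positivity
  have hb0 : 0 ≤ b := by positivity
  have hc0 : 0 ≤ c := by positivity
  have hlog : Real.log (4 * (2 * (max 1 T * ((Δ⁻¹ ^ k)⁻¹) ^ (2 / h) *
      (C / Δ⁻¹ ^ k) ^ (2 / γ)))) = 3 * Real.log 2 + c ^ 2 + 2 * b ^ 2 + 2 * k * a ^ 2 := by
    have e1 : (Δ⁻¹ ^ k)⁻¹ = Δ ^ k := by rw [inv_pow, inv_inv]
    have e2 : C / Δ⁻¹ ^ k = C * Δ ^ k := by rw [div_eq_mul_inv, e1]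
    have h8 : Real.log 8 = 3 * Real.log 2 := by
      rw [show (8 : ℝ) = 2 ^ 3 by norm_num, Real.log_pow]; norm_num
    have hk : 0 < Δ ^ k := by positivity
    rw [e1, e2, ← mul_assoc, show (4 : ℝ) * 2 = 8 by norm_num,
      Real.log_mul (by norm_num) (by positivity), Real.log_mul (by positivity) (by positivity),
      Real.log_mul (by positivity) (by positivity), Real.log_rpow hk, Real.log_rpow (by positivity),
      Real.log_mul (by positivity) (by positivity), Real.log_pow, h8, ha2, hb2, hc2]
    ring
  -- From $\Delta\ge2$, $1/\gamma\ge1/2$ and $1/h\ge1$. Hence the numerical term $3\log 2$ is at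
  -- most $2a^2$, and $k$ becomes $k+1$ in the bound.
  have ha3 : 3 / 2 * Real.log 2 ≤ a ^ 2 := by
    rw [ha2]; nlinarith
  have hk0 : (0 : ℝ) ≤ k := Nat.cast_nonneg k
  have hsq : √(Real.log (4 * (2 * (max 1 T * ((Δ⁻¹ ^ k)⁻¹) ^ (2 / h) *
      (C / Δ⁻¹ ^ k) ^ (2 / γ))))) ≤ 2 * ((k + 1) * a + (b + c)) := by
    rw [Real.sqrt_le_left (by positivity), hlog]
    have h1 : (2 * ((k + 1) * a + (b + c))) ^ 2 = 4 * ((k + 1) ^ 2 * a ^ 2) + 4 * b ^ 2 + 4 * c ^ 2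
        + 8 * ((k + 1) * a * (b + c)) + 8 * (b * c) := by ring
    have h2 : 0 ≤ (k + 1) * a * (b + c) := by positivity
    have h3 : 0 ≤ b * c := by positivity
    have h4 : 0 ≤ (4 * (k : ℝ) ^ 2 + 6 * k) * a ^ 2 := by positivity
    nlinarith [sq_nonneg b, sq_nonneg c]
  linarith

/-- With $x=\Delta^{-1}$, $\Delta\sum(k+1)x^k=\Delta^3/(\Delta-1)^2$ and $\Delta\sum
x^k=\Delta^2/(\Delta-1)$: these are the two rational factors of the theorem. -/
theorem hasSum_dudleyBound {Δ : ℝ} (hΔ : 2 ≤ Δ) (γ h C T : ℝ) :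
    HasSum (fun k : ℕ => Δ * Δ⁻¹ ^ k *
      (4 * ((k + 1) * (√(Real.log Δ) * √(1 / γ + 1 / h)) +
        (√(1 / γ * Real.log C) + √(Real.log (max 1 T))))))
      (dudleyBound Δ γ h C T) := by
  have hΔ0 : 0 < Δ := by linarith
  have hx0 : 0 < Δ⁻¹ := inv_pos.2 hΔ0
  have hx1 : Δ⁻¹ < 1 := inv_lt_one_of_one_lt₀ (by linarith)
  obtain ⟨a, ha⟩ : ∃ a, a = √(Real.log Δ) * √(1 / γ + 1 / h) := ⟨_, rfl⟩
  obtain ⟨b, hb⟩ : ∃ b, b = √(1 / γ * Real.log C) + √(Real.log (max 1 T)) := ⟨_, rfl⟩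
  have h1 : Δ - 1 ≠ 0 := by linarith
  have h2 : 1 - Δ⁻¹ = (Δ - 1) / Δ := by field_simp
  have hval : dudleyBound Δ γ h C T =
      4 * Δ * a * (Δ⁻¹ / (1 - Δ⁻¹) ^ 2) + 4 * Δ * (a + b) * (1 - Δ⁻¹)⁻¹ := by
    rw [h2, dudleyBound, ← hb, mul_right_comm √(Real.log Δ), ← ha]
    field_simp
    ring
  rw [hval, ← ha, ← hb]
  have h3 := ((hasSum_coe_mul_geometric_of_norm_lt_one (𝕜 := ℝ) (r := Δ⁻¹)
      (by rwa [Real.norm_of_nonneg hx0.le])).mul_left (4 * Δ * a)).add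
      ((hasSum_geometric_of_lt_one hx0.le hx1).mul_left (4 * Δ * (a + b)))
  refine h3.congr_fun fun k => ?_
  ring

section Dudley

variable {Ω : Type*} [MeasurableSpace Ω] {P : Measure Ω} [IsProbabilityMeasure P]
  {X : ℝ → Ω → ℂ} {D : ℝ → ℝ → ℝ}

/-- Nets of `[0, ∞)` at the scales `Δ, 1, Δ⁻¹, Δ⁻², …`. -/
theorem exists_nets {γ h C T Δ : ℝ} (hγ : 0 < γ) (hh : 0 < h) (hC : 1 ≤ C)
    (hΔ : 2 ≤ Δ) (hHol : ∀ s t, 0 ≤ s → 0 ≤ t → D s t ≤ C ^ 2 * |s - t| ^ γ)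
    (hTail : ∀ s, T ≤ s → D s 0 ≤ s ^ (-h)) (hdiam : ∀ s, 0 ≤ s → D s 0 ≤ Δ ^ 2) :
    ∃ (N : ℕ → Finset ℝ) (π : ℕ → ℝ → ℝ), N 0 = {0} ∧ (∀ k, ∀ t ∈ N k, 0 ≤ t) ∧
      (∀ k s, 0 ≤ s → π k s ∈ N k) ∧ (∀ k s, 0 ≤ s → D s (π k s) ≤ (Δ * Δ⁻¹ ^ k) ^ 2) ∧
      ∀ k, ((N (k + 1)).card : ℝ) ≤
        2 * (max 1 T * ((Δ⁻¹ ^ k)⁻¹) ^ (2 / h) * (C / Δ⁻¹ ^ k) ^ (2 / γ)) := by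
  have hΔ0 : 0 < Δ := by linarith
  have hx0 : 0 < Δ⁻¹ := inv_pos.2 hΔ0
  have hx1 : Δ⁻¹ ≤ 1 := inv_le_one_of_one_le₀ (by linarith)
  have hnet := fun k : ℕ =>
    exists_net (D := D) hγ hh hC hHol hTail (pow_pos hx0 k) (pow_le_one₀ (n := k) hx0.le hx1)
  choose N π hN hπ hD hcard using hnet
  -- Level $0$ is the single point $0$, at scale $\Delta$ by the diameter bound. Level $k+1$ is the
  -- net of mesh $\Delta^{-k}=\Delta\cdot\Delta^{-(k+1)}$, which causes the index shift in the
  -- count.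
  refine ⟨fun k => Nat.casesOn k {0} N, fun k => Nat.casesOn k (fun _ => 0) π, rfl, ?_, ?_, ?_,
    hcard⟩
  · rintro (_ | k) t ht
    · rw [Finset.mem_singleton.1 ht]
    · exact hN k t ht
  · rintro (_ | k) s hs
    · exact Finset.mem_singleton_self _
    · exact hπ k s hs
  · rintro (_ | k) s hs
    · simpa using hdiam s hs
    · have : Δ * Δ⁻¹ ^ (k + 1) = Δ⁻¹ ^ k := by
        rw [pow_succ]; field_simp
      rw [this]
      exact hD k s hs

theorem ExpIncrements.dudley (hX : ExpIncrements P X D) (hX0 : ∀ ω, X 0 ω = 0)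
    {γ h C T Δ : ℝ} (hγ : 0 < γ) (hγ2 : γ < 2) (hh : 0 < h) (hh1 : h ≤ 1) (hC : 1 ≤ C)
    (hΔ : 2 ≤ Δ) (hHol : ∀ s t, 0 ≤ s → 0 ≤ t → D s t ≤ C ^ 2 * |s - t| ^ γ)
    (hTail : ∀ s, T ≤ s → D s 0 ≤ s ^ (-h)) (hdiam : ∀ s, 0 ≤ s → D s 0 ≤ Δ ^ 2)
    {F : Finset ℝ} (hF : ∀ s ∈ F, 0 ≤ s) :
    ∫⁻ ω, ⨆ s ∈ F, ‖X s ω‖ₑ ∂P ≤ ENNReal.ofReal (dudleyBound Δ γ h C T) := by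
  have hΔ0 : 0 < Δ := by linarith
  have hx0 : 0 < Δ⁻¹ := inv_pos.2 hΔ0
  have hx1 : Δ⁻¹ < 1 := inv_lt_one_of_one_lt₀ (by linarith)
  obtain ⟨N, π, hN0, hN, hπ, hD, hcard⟩ := exists_nets hγ hh hC hΔ hHol hTail hdiam
  refine hX.chaining hX0 (ε := fun k => Δ * Δ⁻¹ ^ k) (fun k => by positivity) ?_ hN0 hN hπ hD
    hcard (fun K => ?_) hF
  · simpa using (tendsto_pow_atTop_nhds_zero_of_lt_one hx0.le hx1).const_mul Δ
  · refine (Finset.sum_le_sum fun k _ => ?_).trans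
      (sum_le_hasSum _ (fun k _ => by positivity) (hasSum_dudleyBound hΔ γ h C T))
    rw [mul_comm 2, mul_assoc]
    exact mul_le_mul_of_nonneg_left (two_mul_sqrt_log_le hγ hγ2 hh hh1 hC hΔ k) (by positivity)

end Dudley

/-! ### A continuous version by dyadic approximation -/

section Dyadic

/-- The dyadic approximation `⌊2ⁿ s⌋ 2⁻ⁿ` from below. -/
noncomputable def dyadicFloor (n : ℕ) (s : ℝ) : ℝ := (⌊2 ^ n * s⌋₊ : ℝ) / 2 ^ n

/-- The largest increment of `x` between neighbouring dyadic points of level `n` in `[0, K]`. -/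
noncomputable def dyadicOsc (x : ℝ → ℂ) (K n : ℕ) : ENNReal :=
  ⨆ j ∈ Finset.range (K * 2 ^ n), ‖x (((j + 1 : ℕ) : ℝ) / 2 ^ n) - x ((j : ℝ) / 2 ^ n)‖ₑ

theorem dyadicFloor_nonneg (n : ℕ) (s : ℝ) : 0 ≤ dyadicFloor n s := by
  unfold dyadicFloor; positivity

theorem abs_sub_dyadicFloor_le (n : ℕ) {s : ℝ} (hs : 0 ≤ s) :
    |s - dyadicFloor n s| ≤ (1 / 2) ^ n := by
  have h2 : (0 : ℝ) < 2 ^ n := by positivity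
  have h3 := Nat.floor_le (a := 2 ^ n * s) (by positivity)
  have h4 := (Nat.lt_floor_add_one (2 ^ n * s)).le
  rw [dyadicFloor, one_div, inv_pow, abs_of_nonneg, ← one_div, sub_le_iff_le_add, ← add_div,
    le_div_iff₀ h2]
  · linarith
  · rw [sub_nonneg, div_le_iff₀ h2]; linarith

theorem floor_lt_of_lt {K n : ℕ} {s : ℝ} (hs : 0 ≤ s) (hsK : s < K) :
    ⌊2 ^ n * s⌋₊ < K * 2 ^ n := by
  rw [Nat.floor_lt (by positivity)]
  push_cast
  rw [mul_comm]
  gcongr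

theorem edist_le_dyadicOsc {x : ℝ → ℂ} {K n a b : ℕ} (hb : b < K * 2 ^ n)
    (hab : a = b ∨ a = b + 1) :
    edist (x ((a : ℝ) / 2 ^ n)) (x ((b : ℝ) / 2 ^ n)) ≤ dyadicOsc x K n := by
  rcases hab with rfl | rfl
  · simp
  · rw [edist_eq_enorm_sub]
    exact le_iSup₂ (f := fun (j : ℕ) (_ : j ∈ Finset.range (K * 2 ^ n)) =>
      ‖x (((j + 1 : ℕ) : ℝ) / 2 ^ n) - x ((j : ℝ) / 2 ^ n)‖ₑ) b (Finset.mem_range.2 hb)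

/-- Refining the level keeps the dyadic floor or moves it to the next point of the finer grid, so at
most one oscillation is paid. -/
theorem edist_dyadicFloor_succ_le {x : ℝ → ℂ} {K : ℕ} (n : ℕ) {s : ℝ} (hs : 0 ≤ s)
    (hsK : s < K) :
    edist (x (dyadicFloor n s)) (x (dyadicFloor (n + 1) s)) ≤ dyadicOsc x K (n + 1) := by
  set m := ⌊2 ^ n * s⌋₊ with hm
  have h3 := Nat.floor_le (a := 2 ^ n * s) (by positivity)
  have h4 := Nat.lt_floor_add_one (2 ^ n * s)
  have e1 : dyadicFloor n s = ((2 * m : ℕ) : ℝ) / 2 ^ (n + 1) := by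
    rw [dyadicFloor, ← hm, pow_succ]; push_cast; field_simp
  have e2 : ⌊2 ^ (n + 1) * s⌋₊ = 2 * m ∨ ⌊2 ^ (n + 1) * s⌋₊ = 2 * m + 1 := by
    have h5 : 2 * m ≤ ⌊2 ^ (n + 1) * s⌋₊ := by
      refine Nat.le_floor ?_
      rw [pow_succ]; push_cast; linarith
    have h6 : ⌊2 ^ (n + 1) * s⌋₊ < 2 * m + 2 := by
      rw [Nat.floor_lt (by positivity), pow_succ]; push_cast; linarith
    omega
  have h7 : 2 * m < K * 2 ^ (n + 1) := by
    have := floor_lt_of_lt (n := n) hs hsK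
    rw [pow_succ, ← mul_assoc]; rw [← hm] at this; omega
  rw [edist_comm, e1]
  exact edist_le_dyadicOsc h7 e2

theorem edist_dyadicFloor_le {x : ℝ → ℂ} {K : ℕ} (n : ℕ) {s t : ℝ} (hs : 0 ≤ s) (ht : t < K)
    (hst : s ≤ t) (h : t - s < (1 / 2) ^ n) :
    edist (x (dyadicFloor n s)) (x (dyadicFloor n t)) ≤ dyadicOsc x K n := by
  have h2 : (0 : ℝ) < 2 ^ n := by positivity
  have ht0 : 0 ≤ t := hs.trans hst
  have h5 : ⌊2 ^ n * s⌋₊ ≤ ⌊2 ^ n * t⌋₊ := Nat.floor_le_floor (by gcongr)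
  have h6 : ⌊2 ^ n * t⌋₊ < ⌊2 ^ n * s⌋₊ + 2 := by
    rw [Nat.floor_lt (by positivity)]
    have h4 := Nat.lt_floor_add_one (2 ^ n * s)
    have h7 : 2 ^ n * (t - s) < 1 := by
      calc 2 ^ n * (t - s) < 2 ^ n * (1 / 2) ^ n := by gcongr
        _ = 1 := by rw [← mul_pow]; norm_num
    push_cast; linarith
  rw [edist_comm]
  exact edist_le_dyadicOsc (floor_lt_of_lt hs (hst.trans_lt ht)) (by omega)

/-- If the dyadic oscillations of `x` are summable on every `[0, K]`, then the dyadic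
approximations of `x` converge to a continuous function. -/
theorem exists_continuous_limit {x : ℝ → ℂ}
    (hx : ∀ K : ℕ, ∑' n, dyadicOsc x K n ≠ ⊤) :
    (∀ s, 0 ≤ s → ∃ z, Tendsto (fun n => x (dyadicFloor n s)) atTop (𝓝 z)) ∧
    ∀ w : ℝ → ℂ, (∀ s, 0 ≤ s → Tendsto (fun n => x (dyadicFloor n s)) atTop (𝓝 (w s))) →
      ContinuousOn w (Ici 0) := by
  have hR : ∀ K : ℕ, ∑' n, dyadicOsc x K (n + 1) ≠ ⊤ := fun K =>
    ne_top_of_le_ne_top (hx K)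
      (ENNReal.tsum_comp_le_tsum_of_injective (add_left_injective 1) _)
  refine ⟨fun s hs => ?_, fun w hw => ?_⟩
  · obtain ⟨K, hK⟩ := exists_nat_gt s
    refine cauchySeq_tendsto_of_complete
      (cauchySeq_of_edist_le_of_tsum_ne_top _
        (fun n => edist_dyadicFloor_succ_le n hs hK) (hR K))
  · intro s hs
    have hs0 : (0 : ℝ) ≤ s := hs
    obtain ⟨K, hK⟩ := exists_nat_gt s
    have hosc : Tendsto (fun n => dyadicOsc x K n) atTop (𝓝 0) :=
      ENNReal.tendsto_atTop_zero_of_tsum_ne_top (hx K)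
    have htail : Tendsto (fun n => ∑' m, dyadicOsc x K (n + m + 1)) atTop (𝓝 0) := by
      have := ENNReal.tendsto_sum_nat_add _ (hR K)
      simpa only [add_comm] using this
    have hlim : Tendsto (fun n => (∑' m, dyadicOsc x K (n + m + 1) + dyadicOsc x K n) +
        ∑' m, dyadicOsc x K (n + m + 1)) atTop (𝓝 0) := by
      simpa using (htail.add hosc).add htail
    have happ : ∀ t : ℝ, 0 ≤ t → t < K → ∀ n,
        edist (x (dyadicFloor n t)) (w t) ≤ ∑' m, dyadicOsc x K (n + m + 1) := fun t ht htK n =>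
      edist_le_tsum_of_edist_le_of_tendsto _
        (fun n => edist_dyadicFloor_succ_le n ht htK) (hw t ht) n
    rw [EMetric.continuousWithinAt_iff]
    intro e he
    obtain ⟨n, hn⟩ := (hlim.eventually (gt_mem_nhds he)).exists
    -- Being within $2^{-n}$ makes the floors equal or adjacent; being within $K-s$ keeps $t$ below
    -- $K$, where the same oscillations apply.
    have hδ : 0 < min ((1 / 2 : ℝ) ^ n) (K - s) := lt_min (by positivity) (by linarith)
    refine ⟨ENNReal.ofReal (min ((1 / 2 : ℝ) ^ n) (K - s)), ENNReal.ofReal_pos.2 hδ,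
      fun t ht hst => ?_⟩
    have ht0 : (0 : ℝ) ≤ t := ht
    rw [edist_dist, ENNReal.ofReal_lt_ofReal_iff hδ, Real.dist_eq, lt_min_iff] at hst
    have htK : t < K := by linarith [le_abs_self (t - s), hst.2]
    have hmid : edist (x (dyadicFloor n t)) (x (dyadicFloor n s)) ≤ dyadicOsc x K n := by
      rcases le_total s t with h | h
      · rw [edist_comm]
        exact edist_dyadicFloor_le n hs0 htK h ((le_abs_self _).trans_lt hst.1)
      · refine edist_dyadicFloor_le n ht0 hK h (lt_of_le_of_lt ?_ hst.1)
        rw [abs_sub_comm]; exact le_abs_self _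
    refine lt_of_le_of_lt ?_ hn
    calc edist (w t) (w s) ≤ edist (w t) (x (dyadicFloor n t)) +
          edist (x (dyadicFloor n t)) (x (dyadicFloor n s)) +
          edist (x (dyadicFloor n s)) (w s) := edist_triangle4 _ _ _ _
      _ ≤ _ := by
        refine add_le_add (add_le_add ?_ hmid) (happ s hs0 hK n)
        rw [edist_comm]
        exact happ t ht0 htK n

end Dyadic

section Version

variable {Ω : Type*} [MeasurableSpace Ω] {P : Measure Ω} [IsProbabilityMeasure P]
  {X : ℝ → Ω → ℂ} {D : ℝ → ℝ → ℝ}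

theorem half_pow_rpow (γ : ℝ) (n : ℕ) :
    ((1 / 2 : ℝ) ^ n) ^ (γ / 2) = ((1 / 2 : ℝ) ^ (γ / 2)) ^ n := by
  rw [← Real.rpow_natCast, ← Real.rpow_mul (by norm_num), mul_comm, Real.rpow_mul (by norm_num),
    Real.rpow_natCast]

theorem half_rpow_lt_one {γ : ℝ} (hγ : 0 < γ) : (1 / 2 : ℝ) ^ (γ / 2) < 1 :=
  Real.rpow_lt_one (by norm_num) (by norm_num) (by positivity)

/-- The factor from the maximal inequality over $K2^n$ increments grows at most linearly in $n$,
while the Hölder factor decays geometrically. -/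
theorem summable_dyadic_bound {γ C : ℝ} (hγ : 0 < γ) (K : ℕ) (hK : 0 < K) :
    Summable fun n : ℕ => 2 * (C * ((1 / 2 : ℝ) ^ n) ^ (γ / 2)) *
      √(Real.log (4 * (K * 2 ^ n))) := by
  set x : ℝ := (1 / 2 : ℝ) ^ (γ / 2) with hx
  have hx0 : 0 < x := by positivity
  have hx1 : x < 1 := half_rpow_lt_one hγ
  have hxn : ∀ n : ℕ, ((1 / 2 : ℝ) ^ n) ^ (γ / 2) = x ^ n := half_pow_rpow γ
  have hnx : ‖x‖ < 1 := by rwa [Real.norm_of_nonneg hx0.le]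
  have h1 : Summable fun n : ℕ => (n : ℝ) * x ^ n := by
    simpa using summable_pow_mul_geometric_of_norm_lt_one 1 hnx
  have h2 : Summable fun n : ℕ => x ^ n := summable_geometric_of_lt_one hx0.le hx1
  have hK' : (1 : ℝ) ≤ K := by exact_mod_cast hK
  have hlog : 0 ≤ Real.log (4 * K) := Real.log_nonneg (by linarith)
  have hb : ∀ n : ℕ, √(Real.log (4 * (K * 2 ^ n))) ≤ (1 + Real.log (4 * K)) + n := by
    intro n
    have hn0 : (0 : ℝ) ≤ n := Nat.cast_nonneg n
    rw [Real.sqrt_le_left (by positivity), ← mul_assoc, Real.log_mul (by positivity)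
      (by positivity), Real.log_pow]
    have : Real.log 2 ≤ 1 := by linarith [Real.log_two_lt_d9]
    nlinarith
  refine Summable.of_norm_bounded
    (g := fun n : ℕ => 2 * |C| * (1 + Real.log (4 * K)) * x ^ n + 2 * |C| * ((n : ℝ) * x ^ n))
    ((h2.mul_left _).add (h1.mul_left _)) fun n => ?_
  rw [hxn, norm_mul, norm_mul, norm_mul, Real.norm_of_nonneg (Real.sqrt_nonneg _),
    Real.norm_of_nonneg (pow_nonneg hx0.le n), Real.norm_two, Real.norm_eq_abs]
  calc 2 * (|C| * x ^ n) * √(Real.log (4 * (K * 2 ^ n)))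
      ≤ 2 * (|C| * x ^ n) * ((1 + Real.log (4 * K)) + n) := by gcongr; exact hb n
    _ = _ := by ring

/-- Existence of a version with continuous paths on `[0, ∞)`. -/
theorem ExpIncrements.exists_continuous_version (hX : ExpIncrements P X D) {γ C : ℝ}
    (hγ : 0 < γ) (hC : 0 < C)
    (hHol : ∀ s t, 0 ≤ s → 0 ≤ t → D s t ≤ C ^ 2 * |s - t| ^ γ) :
    ∃ W : ℝ → Ω → ℂ, (∀ s, 0 ≤ s → W s =ᵐ[P] X s) ∧
      ∀ᵐ ω ∂P, ContinuousOn (fun s => W s ω) (Ici 0) := by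
  have hHol' : ∀ n : ℕ, ∀ s t, 0 ≤ s → 0 ≤ t → |s - t| ≤ (1 / 2) ^ n →
      D s t ≤ (C * ((1 / 2 : ℝ) ^ n) ^ (γ / 2)) ^ 2 := fun n s t hs ht hst => by
    refine (hHol s t hs ht).trans ?_
    rw [mul_pow, ← Real.rpow_natCast (((1 / 2 : ℝ) ^ n) ^ (γ / 2)), ← Real.rpow_mul
      (by positivity), show γ / 2 * ((2 : ℕ) : ℝ) = γ by push_cast; ring]
    gcongr
  have hpos : ∀ n : ℕ, 0 < C * ((1 / 2 : ℝ) ^ n) ^ (γ / 2) := fun n => by positivity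
  -- summability of the oscillations
  have hosc : ∀ᵐ ω ∂P, ∀ K : ℕ, ∑' n, dyadicOsc (fun s => X s ω) K n ≠ ⊤ := by
    refine ae_all_iff.2 fun K => ?_
    rcases K.eq_zero_or_pos with rfl | hK
    · refine ae_of_all _ fun ω => ?_
      simp [dyadicOsc]
    have hm : ∀ n, AEMeasurable (fun ω => dyadicOsc (fun s => X s ω) K n) P := fun n =>
      AEMeasurable.biSup _ (Finset.range (K * 2 ^ n)).countable_toSet fun j _ =>
        ((hX.aemeasurable _ (by positivity)).sub (hX.aemeasurable _ (by positivity))).enorm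
    have hle : ∀ n, ∫⁻ ω, dyadicOsc (fun s => X s ω) K n ∂P ≤
        ENNReal.ofReal (2 * (C * ((1 / 2 : ℝ) ^ n) ^ (γ / 2)) *
          √(Real.log (4 * (K * 2 ^ n)))) := fun n => by
      refine hX.lintegral_iSup_le (I := Finset.range (K * 2 ^ n))
        (Finset.nonempty_range_iff.2 (by positivity)) (fun _ _ => by positivity)
        (fun _ _ => by positivity) (hpos n) (fun j _ => ?_) (by simp)
      refine hHol' n _ _ (by positivity) (by positivity) (le_of_eq ?_)
      push_cast
      rw [← sub_div, add_sub_cancel_left, abs_of_nonneg (by positivity), one_div, one_div, inv_pow]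
    have hfin : ∫⁻ ω, ∑' n, dyadicOsc (fun s => X s ω) K n ∂P ≠ ⊤ := by
      rw [lintegral_tsum hm]
      exact ne_top_of_le_ne_top (summable_dyadic_bound hγ K hK).tsum_ofReal_ne_top
        (ENNReal.tsum_le_tsum hle)
    exact (ae_lt_top' (AEMeasurable.tsum hm) hfin).mono fun _ h => h.ne
  -- convergence to `X s`
  have hconv : ∀ s, 0 ≤ s → ∀ᵐ ω ∂P,
      Tendsto (fun n => X (dyadicFloor n s) ω) atTop (𝓝 (X s ω)) := by
    intro s hs
    have hm : ∀ n, AEMeasurable (fun ω => ‖X s ω - X (dyadicFloor n s) ω‖ₑ) P := fun n =>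
      ((hX.aemeasurable _ hs).sub (hX.aemeasurable _ (dyadicFloor_nonneg n s))).enorm
    have hfin : ∫⁻ ω, ∑' n, ‖X s ω - X (dyadicFloor n s) ω‖ₑ ∂P ≠ ⊤ := by
      rw [lintegral_tsum hm]
      have hsum : Summable fun n : ℕ => 4 * (C * ((1 / 2 : ℝ) ^ n) ^ (γ / 2)) := by
        simp only [half_pow_rpow]
        exact ((summable_geometric_of_lt_one (by positivity)
          (half_rpow_lt_one hγ)).mul_left C).mul_left 4
      refine ne_top_of_le_ne_top hsum.tsum_ofReal_ne_top (ENNReal.tsum_le_tsum fun n => ?_)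
      exact hX.lintegral_enorm_sub_le hs (dyadicFloor_nonneg n s) (hpos n)
        (hHol' n _ _ hs (dyadicFloor_nonneg n s) (abs_sub_dyadicFloor_le n hs))
    filter_upwards [ae_lt_top' (AEMeasurable.tsum hm) hfin] with ω hω
    rw [tendsto_iff_edist_tendsto_0]
    simpa only [edist_comm, edist_eq_enorm_sub] using
      ENNReal.tendsto_atTop_zero_of_tsum_ne_top hω.ne
  -- Outside a null set independent of $s$ the limit exists for every $s\ge0$; the default value of
  -- `limUnder` elsewhere is harmless.
  refine ⟨fun s ω => limUnder atTop fun n => X (dyadicFloor n s) ω, fun s hs => ?_, ?_⟩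
  · filter_upwards [hconv s hs] with ω hω
    exact hω.limUnder_eq
  · filter_upwards [hosc] with ω hω
    obtain ⟨h1, h2⟩ := exists_continuous_limit hω
    exact h2 _ fun s hs => tendsto_nhds_limUnder (h1 s hs)

end Version

/-! ### From finite suprema to the supremum over all scales -/

section Supremum

variable {Ω : Type*} [MeasurableSpace Ω] {P : Measure Ω} {X W : ℝ → Ω → ℂ}

/-- The expected supremum of a continuous version is controlled by the suprema over finite sets. -/
theorem lintegral_iSup_version_le (hXm : ∀ s, 0 ≤ s → AEMeasurable (X s) P)
    (hWX : ∀ s, 0 < s → W s =ᵐ[P] X s)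
    (hW : ∀ᵐ ω ∂P, ContinuousOn (fun s => W s ω) (Ioi 0)) {B : ENNReal}
    (hB : ∀ F : Finset ℝ, (∀ s ∈ F, 0 ≤ s) → ∫⁻ ω, ⨆ s ∈ F, ‖X s ω‖ₑ ∂P ≤ B) :
    ∫⁻ ω, ⨆ s ∈ Ioi (0 : ℝ), ‖W s ω‖ₑ ∂P ≤ B := by
  classical
  set ι := {q : ℚ // (0 : ℝ) < q}
  have hdense : Ioi (0 : ℝ) ⊆ closure (Ioi 0 ∩ range ((↑) : ℚ → ℝ)) := by
    have : Dense (range ((↑) : ℚ → ℝ)) := Rat.denseRange_cast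
    exact this.open_subset_closure_inter isOpen_Ioi
  have hq : ∀ᵐ ω ∂P, ∀ i : ι, W (i.1 : ℝ) ω = X (i.1 : ℝ) ω :=
    ae_all_iff.2 fun i => hWX _ i.2
  calc ∫⁻ ω, ⨆ s ∈ Ioi (0 : ℝ), ‖W s ω‖ₑ ∂P
      ≤ ∫⁻ ω, ⨆ i : ι, ‖X (i.1 : ℝ) ω‖ₑ ∂P := by
        -- The uncountable supremum need not be measurable, but monotonicity of the lower integral
        -- does not ask for it. Continuity bounds it by the supremum over positive rationals, where
        -- $W=X$ simultaneously almost surely.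
        refine lintegral_mono_ae ?_
        filter_upwards [hW, hq] with ω hc hω
        refine iSup₂_le fun s hs => ?_
        have hne : (𝓝[Ioi 0 ∩ range ((↑) : ℚ → ℝ)] s).NeBot :=
          mem_closure_iff_nhdsWithin_neBot.1 (hdense hs)
        have ht : Tendsto (fun u => ‖W u ω‖ₑ) (𝓝[Ioi 0 ∩ range ((↑) : ℚ → ℝ)] s)
            (𝓝 ‖W s ω‖ₑ) :=
          (((hc s hs).mono inter_subset_left).tendsto).enorm
        refine le_of_tendsto ht (eventually_nhdsWithin_of_forall ?_)
        rintro _ ⟨hu, q, rfl⟩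
        have := hω ⟨q, hu⟩
        dsimp only at this
        rw [this]
        exact le_iSup (fun i : ι => ‖X (i.1 : ℝ) ω‖ₑ) ⟨q, hu⟩
    _ = ∫⁻ ω, ⨆ F : Finset ι, ⨆ i ∈ F, ‖X (i.1 : ℝ) ω‖ₑ ∂P := by
        simp only [iSup_eq_iSup_finset fun i : ι => ‖X (i.1 : ℝ) _‖ₑ]
    _ = ⨆ F : Finset ι, ∫⁻ ω, ⨆ i ∈ F, ‖X (i.1 : ℝ) ω‖ₑ ∂P := by
        -- Monotone convergence along the directed family of finite subsets of a countable set.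
        refine lintegral_iSup_directed (fun F => ?_) ?_
        · exact AEMeasurable.biSup _ F.countable_toSet fun i _ => (hXm _ i.2.le).enorm
        · refine Monotone.directed_le fun F G hFG ω => ?_
          exact biSup_mono fun i hi => hFG hi
    _ ≤ B := by
        refine iSup_le fun F => (lintegral_mono fun ω => ?_).trans
          (hB (F.image fun i : ι => (i.1 : ℝ)) ?_)
        · exact iSup₂_le fun i hi => le_iSup₂ (f := fun (s : ℝ)
            (_ : s ∈ F.image fun i : ι => (i.1 : ℝ)) => ‖X s ω‖ₑ) _ (Finset.mem_image_of_mem _ hi)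
        · intro s hs
          obtain ⟨i, -, rfl⟩ := Finset.mem_image.1 hs
          exact i.2.le

end Supremum

/-! ### Application to the wavelet transform of the noise -/

section Noise

variable {Ω : Type*} [MeasurableSpace Ω] {P : Measure Ω} [IsProbabilityMeasure P]
  {Φ : ℝ → Ω → ℝ} {p : ℝ → ℝ} {ψ : ℝ → ℂ}

theorem expIncrements_awtNoise (hΦ : IsGaussianNoise P Φ p)
    (hm : Measurable (fun q : ℝ × Ω => Φ q.1 q.2)) (hψ : IsAnalyticWavelet ψ) :
    ExpIncrements P (awtNoise ψ Φ) (distSq p ψ) where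
  aemeasurable _ hs := (aestronglyMeasurable_awtNoise hΦ hm hψ hs).aemeasurable
  exp_le _ _ hs ht := lintegral_exp_awtNoise_sub_le hΦ hm hψ hs ht

theorem one_le_holderConst (P : Measure Ω) (ψ : ℝ → ℂ) (Φ : ℝ → Ω → ℝ) (γ C₁ : ℝ) :
    1 ≤ holderConst P ψ Φ γ C₁ := le_max_left _ _

theorem distSq_le_holderConst (hΦ : IsGaussianNoise P Φ p) {γ C₁ : ℝ}
    (hp : HighFrequencyDecay p γ C₁) (hψ : IsAnalyticWavelet ψ)
    (hlip : ∃ K : NNReal, LipschitzOnWith K (fourierHat ψ) (Ici 0)) (s t : ℝ) (hs : 0 ≤ s)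
    (ht : 0 ≤ t) : distSq p ψ s t ≤ holderConst P ψ Φ γ C₁ ^ 2 * |s - t| ^ γ := by
  refine (distSq_le_rpow hΦ.density_integrable hp hψ hlip hs ht).trans ?_
  refine mul_le_mul_of_nonneg_right ?_ (by positivity)
  have hγ := hp.gamma_pos
  have hγ2 : 0 < 2 - γ := by linarith [hp.gamma_lt_two]
  have hC := hp.const_pos
  have hM0 := supNorm_nonneg (fourierHat ψ)
  have hK0 := lipConst_nonneg (fourierHat ψ)
  have hv := variance_nonneg (Φ 0) P
  set I := C₁ * (1 / γ + 2 / (2 - γ)) * (2 * supNorm (fourierHat ψ)) ^ (2 - γ)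
        * lipConst (fourierHat ψ) ^ γ + 2 * supNorm (fourierHat ψ) ^ 2 * Var[Φ 0; P] with hI
  have h1 : C₁ * (1 / γ + 1 / (2 - γ)) * (2 * supNorm (fourierHat ψ)) ^ (2 - γ)
      * lipConst (fourierHat ψ) ^ γ ≤ I := by
    rw [hI]
    refine le_add_of_le_of_nonneg ?_ (by positivity)
    -- The Hölder bound proved here is sharper than $C_2$ requires: the doubled term and the
    -- variance term only enlarge the constant.
    have : 1 / (2 - γ) ≤ 2 / (2 - γ) := by gcongr; norm_num
    gcongr
  have h0 : 0 ≤ I := by positivity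
  calc _ ≤ I := h1
    _ = √I ^ 2 := (Real.sq_sqrt h0).symm
    _ ≤ _ := pow_le_pow_left₀ (Real.sqrt_nonneg _) (le_max_right _ _) 2

theorem distSq_zero_le_diamConst (hΦ : IsGaussianNoise P Φ p)
    (hm : Measurable (fun q : ℝ × Ω => Φ q.1 q.2)) (hψ : IsAnalyticWavelet ψ) (s : ℝ)
    (hs : 0 ≤ s) : distSq p ψ s 0 ≤ diamConst P ψ Φ ^ 2 := by
  rcases hs.eq_or_lt with rfl | hs
  · simp only [distSq, sub_self, norm_zero]
    simp [sq_nonneg]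
  -- The real supremum in `diamConst` would default to $0$ for an unbounded family, so boundedness
  -- has to be established.
  have hbdd : BddAbove (range fun s : Ioi (0 : ℝ) => secondMoment P ψ Φ (s : ℝ)) := by
    refine ⟨(∫ l, p l) * supNorm (fourierHat ψ) ^ 2, ?_⟩
    rintro _ ⟨u, rfl⟩
    have hu : (0 : ℝ) < u := u.2
    dsimp only
    rw [secondMoment_eq hΦ hm hψ hu.le]
    exact distSq_zero_le hΦ.density_pos hΦ.density_integrable hψ _
  have h1 : distSq p ψ s 0 ≤ ⨆ u : Ioi (0 : ℝ), secondMoment P ψ Φ (u : ℝ) := by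
    rw [← secondMoment_eq hΦ hm hψ hs.le]
    exact le_ciSup hbdd ⟨s, hs⟩
  calc _ ≤ _ := h1
    _ = √(⨆ u : Ioi (0 : ℝ), secondMoment P ψ Φ (u : ℝ)) ^ 2 :=
      (Real.sq_sqrt ((distSq_nonneg hΦ.density_pos _ _).trans h1)).symm
    _ ≤ _ := pow_le_pow_left₀ (Real.sqrt_nonneg _) (le_max_right _ _) 2

end Noise

end AWT

theorem mainTheorem6 {Ω : Type*} [MeasurableSpace Ω] (P : Measure Ω) [IsProbabilityMeasure P]
    (Φ : ℝ → Ω → ℝ) (hΦ_meas : Measurable (fun q : ℝ × Ω => Φ q.1 q.2))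
    (p : ℝ → ℝ) (hΦ : AWT.IsGaussianNoise P Φ p)
    (ψ : ℝ → ℂ) (hψ : AWT.IsAnalyticWavelet ψ)
    (hψ_lip : ∃ K : NNReal, LipschitzOnWith K (AWT.fourierHat ψ) (Ici 0))
    (γ C₁ : ℝ) (hp : AWT.HighFrequencyDecay p γ C₁)
    (h : ℝ) (hh : 0 < h)
    (hdep : (∃ H : ℝ, AWT.LongRangeDependent p H ∧ h < H) ∨
      (AWT.ShortRangeDependent p ∧ h ≤ 1)) :
    (∃ W : ℝ → Ω → ℂ, AWT.IsContinuousVersion P ψ Φ W) ∧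
    (h < 1 → ∃ T : ℝ, AWT.IsDecayThreshold P ψ Φ h T) ∧
    ∀ T : ℝ, AWT.IsDecayThreshold P ψ Φ h T →
      ∀ W : ℝ → Ω → ℂ, AWT.IsContinuousVersion P ψ Φ W →
        ∫⁻ ω, ⨆ s ∈ Ioi (0 : ℝ), ‖W s ω‖ₑ ∂P ≤
          ENNReal.ofReal (AWT.dudleyBound (AWT.diamConst P ψ Φ) γ h
            (AWT.holderConst P ψ Φ γ C₁) T) := by
  have hX := AWT.expIncrements_awtNoise hΦ hΦ_meas hψ
  have hHol := AWT.distSq_le_holderConst hΦ hp hψ hψ_lip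
  have hC1 := AWT.one_le_holderConst P ψ Φ γ C₁
  have hh1 : h ≤ 1 := by
    rcases hdep with ⟨H, ⟨_, hH1, _⟩, hhH⟩ | ⟨_, h1⟩
    · exact (hhH.trans hH1).le
    · exact h1
  refine ⟨?_, fun hlt => ?_, fun T hT W hW => ?_⟩
  · obtain ⟨W, hW1, hW2⟩ :=
      hX.exists_continuous_version hp.gamma_pos (zero_lt_one.trans_le hC1) hHol
    exact ⟨W, fun s hs => hW1 s hs.le, hW2.mono fun ω hω => hω.mono Ioi_subset_Ici_self⟩
  · obtain ⟨T, hT0, hT⟩ :=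
      AWT.exists_forall_distSq_le_rpow hΦ.density_integrable hp hψ hh hlt hdep
    refine ⟨T, hT0, fun s hs => ?_⟩
    rw [AWT.secondMoment_eq hΦ hΦ_meas hψ (hT0.le.trans hs)]
    exact hT s hs
  · refine AWT.lintegral_iSup_version_le hX.aemeasurable hW.ae_eq hW.continuousOn fun F hF => ?_
    refine hX.dudley (AWT.awtNoise_zero ψ Φ) hp.gamma_pos hp.gamma_lt_two hh hh1 hC1
      (le_max_left _ _) hHol (fun s hs => ?_) (AWT.distSq_zero_le_diamConst hΦ hΦ_meas hψ) hF
    rw [← AWT.secondMoment_eq hΦ hΦ_meas hψ (hT.1.le.trans hs)]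
    exact hT.2 s hs
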